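/- Consider a dual-hop RF/FSO relay system with $N\ge 1$ relays, and fix a rank $1\le m\le N$. **First hop (outdated correlated Rayleigh fading).** The pairs $(\tilde h_l,h_l)$, $l=1,\dots,N$, of outdated and current RF gains are independent and identically distributed, with the law of $(z,\sqrt{\rho}\,z+\sqrt{1-\rho}\,w)$ where $z,w\sim\mathcal{CN}(0,v)$ are independent, $v>0$, and $\rho\in[0,1]$ is the time correlation coefficient. With source power $P_1>0$ and noise power $\sigma_0^2>0$, the outdated and current SNRs are $P_1|\tilde h_l|^2/\sigma_0^2$ and $P_1|h_l|^2/\sigma_0^2$, and $\overline\gamma_1=P_1v/\sigma_0^2$. Partial relay selection picks the relay whose outdated SNR is the $m$-th smallest; write $h_{m}$ for the current gain of that relay and $\gamma_{1(m)}=P_1|h_m|^2/\sigma_0^2$ for its current SNR. **Second hop (Gamma-Gamma fading).** The second-hop SNRs of the relays are jointly independent of all the RF gains, and each of them has the density $$f(x)=\frac{(\alpha\beta)^{\frac{\alpha+\beta}{2}}x^{\frac{\alpha+\beta}{4}-1}}{\Gamma(\alpha)\Gamma(\beta)\,\overline\gamma_2^{\frac{\alpha+\beta}{4}}}K_{\alpha-\beta}\Big(2\sqrt{\alpha\beta\sqrt{x/\overline\gamma_2}}\Big),\qquad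 x>0,$$ where $\alpha,\beta,\overline\gamma_2>0$ and $K_\nu$ is the modified Bessel function of the second kind. Write $\gamma_{2(m)}$ for the second-hop SNR of the selected relay. **Hardware.** The relay amplifier has saturation magnitude $A>0$ and AM/AM characteristic either $A_m(r)=\min(r,A)$ (SEL) or $A_m(r)=A^2r/(A^2+r^2)$ (TWTA, AM/PM conversion neglected). For an input $\phi\sim\mathcal{CN}(0,\sigma^2)$, $\sigma>0$, let $\delta=E[A_m(|\phi|)|\phi|]/\sigma^2$ and $\sigma_d^2=E[(A_m(|\phi|)-\delta|\phi|)^2]$ be the linear scale and the distortion variance of its Bussgang decomposition. The fixed gain is $G$ with $G^2=\sigma^2/(E[|h_m|^2]P_1+\sigma_0^2)$, and $\kappa=1+\sigma_d^2/(\delta^2G^2\sigma_0^2)$. The IQ imbalance of the destination, with real magnitude and phase parameters $\zeta,\theta$, is given by $\omega_1=\frac{1+\zeta e^{-j\theta}}2\neq 0$, $\omega_2=\frac{1-\zeta e^{j\theta}}2$, and $\mathrm{ILR}=|\omega_2/\omega_1|^2$. The end-to-end signal-to-noise-plus-distortion ratio is $$\gamma_{e2e}=\frac{\gamma_{1(m)}\gamma_{2(m)}}{\mathrm{ILR}\,\gamma_{1(m)}\gamma_{2(m)}+(1+\mathrm{ILR})\kappa\gamma_{2(m)}+(1+\mathrm{ILR})(E[\gamma_{1(m)}]+\kappa)}.$$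 **Claim.** Let $\gamma_{th}>0$ and $P_{out}=\Pr[\gamma_{e2e}<\gamma_{th}]$. If $\mathrm{ILR}\,\gamma_{th}<1$ (that is, $\gamma_{th}<1/\mathrm{ILR}$, with $1/0=\infty$), then $$P_{out}=1-\frac{2^{\alpha+\beta-2}}{\pi\Gamma(\alpha)\Gamma(\beta)}\,m\binom Nm\sum_{n=0}^{m-1}\binom{m-1}{n}\frac{(-1)^n}{N-m+n+1}\exp\!\Big(-\frac{(N-m+n+1)\kappa(1+\mathrm{ILR})\gamma_{th}}{((N-m+n)(1-\rho)+1)(1-\mathrm{ILR}\,\gamma_{th})\overline\gamma_1}\Big)\,G^{5,0}_{0,5}\!\Big(z_n\,\Big|\,{-\atop \frac\alpha2,\frac{\alpha+1}2,\frac\beta2,\frac{\beta+1}2,0}\Big),$$ $$z_n=\frac{(\alpha\beta)^2(E[\gamma_{1(m)}]+\kappa)(N-m+n+1)(1+\mathrm{ILR})\gamma_{th}}{16((N-m+n)(1-\rho)+1)(1-\mathrm{ILR}\,\gamma_{th})\overline\gamma_1\overline\gamma_2},$$ where $G^{5,0}_{0,5}$ is the Meijer G function, here $$G^{5,0}_{0,5}\Big(z\,\Big|\,{-\atop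 b_1,\dots,b_5}\Big)=\frac1{2\pi i}\int_{c-i\infty}^{c+i\infty}\prod_{j=1}^5\Gamma(b_j-s)\,z^s\,ds,\qquad c<\min_j b_j.$$ Otherwise, i.e. if $\mathrm{ILR}\,\gamma_{th}\ge 1$, $P_{out}=1$. -/

import Mathlib

open MeasureTheory ProbabilityTheory

noncomputable section

namespace RelayFSO

/-! ### Special functions -/

/-- Modified Bessel function of the second kind `K_ν(x)` (real order, `x > 0`). -/
def besselK (ν x : ℝ) : ℝ :=
  ∫ t in Set.Ioi (0 : ℝ), Real.exp (-x * Real.cosh t) * Real.cosh (ν * t)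

/-- Integrand of the Mellin-Barnes integral of `G^{m,n}_{p,q}`, without the power of the argument:
`∏_{j ≤ m} Γ(b_j - s) ∏_{j ≤ n} Γ(1 - a_j + s) / (∏_{j > m} Γ(1 - b_j + s) ∏_{j > n} Γ(a_j - s))`. -/
def meijerKernel (m n : ℕ) {p q : ℕ} (a : Fin p → ℂ) (b : Fin q → ℂ) (s : ℂ) : ℂ :=
  (∏ j : Fin q, if (j : ℕ) < m then Complex.Gamma (b j - s)
    else (Complex.Gamma (1 - b j + s))⁻¹) *
  (∏ j : Fin p, if (j : ℕ) < n then Complex.Gamma (1 - a j + s)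
    else (Complex.Gamma (a j - s))⁻¹)

/-- The upward vertical line `Re s = c` separates the poles of the `Γ(b_j - s)`, `j ≤ m`
(on its right), from those of the `Γ(1 - a_j + s)`, `j ≤ n` (on its left). -/
def SeparatesPoles (m n : ℕ) {p q : ℕ} (a : Fin p → ℂ) (b : Fin q → ℂ) (c : ℝ) : Prop :=
  (∀ j : Fin q, (j : ℕ) < m → c < (b j).re) ∧ (∀ j : Fin p, (j : ℕ) < n → (a j).re - 1 < c)

open Classical in
/-- Meijer's function
`G^{m,n}_{p,q}(z | a; b) = (1 / 2πi) ∫_L (kernel s) z^s ds`, with `L` a vertical line that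
separates the two families of poles. This is the standard contour for `2 (m + n) > p + q`,
`|arg z| < (m + n - (p + q) / 2) π`, whenever such a line exists; the integral does not depend on
the line, by Cauchy's theorem. -/
def meijerG (m n : ℕ) {p q : ℕ} (a : Fin p → ℂ) (b : Fin q → ℂ) (z : ℂ) : ℂ :=
  if h : ∃ c : ℝ, SeparatesPoles m n a b c then
    (1 / (2 * (Real.pi : ℂ))) * ∫ t : ℝ,
      meijerKernel m n a b ((h.choose : ℂ) + t * Complex.I) * z ^ ((h.choose : ℂ) + t * Complex.I)
  else 0

/-! ### Fading laws -/

/-- The circularly symmetric complex Gaussian law `CN(0, v)`, `v = E|z|²`. -/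
def complexGaussian (v : ℝ) : Measure ℂ :=
  ((gaussianReal 0 (v / 2).toNNReal).prod (gaussianReal 0 (v / 2).toNNReal)).map
    (fun p : ℝ × ℝ => (p.1 : ℂ) + p.2 * Complex.I)

/-- Joint law of the outdated and the current gain of a Rayleigh channel with mean power `v`:
`h = √ρ h̃ + √(1 - ρ) w` with `h̃`, `w` independent `CN(0, v)`. Both gains are `CN(0, v)`, and `ρ`
is the correlation coefficient of the powers `|h̃|²` and `|h|²`. -/
def outdatedGainLaw (v ρ : ℝ) : Measure (ℂ × ℂ) :=
  ((complexGaussian v).prod (complexGaussian v)).map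
    (fun p : ℂ × ℂ => (p.1, (Real.sqrt ρ : ℂ) * p.1 + (Real.sqrt (1 - ρ) : ℂ) * p.2))

/-- Density (for `x > 0`) of the SNR of a Gamma-Gamma fading channel. -/
def gammaGammaPDF (α β γbar₂ x : ℝ) : ℝ :=
  (α * β) ^ ((α + β) / 2) * x ^ ((α + β) / 4 - 1) /
      (Real.Gamma α * Real.Gamma β * γbar₂ ^ ((α + β) / 4)) *
    besselK (α - β) (2 * Real.sqrt (α * β * Real.sqrt (x / γbar₂)))

/-- Law of the SNR of a Gamma-Gamma fading channel. -/
def gammaGammaSNR (α β γbar₂ : ℝ) : Measure ℝ :=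
  (volume.restrict (Set.Ioi 0)).withDensity (fun x => ENNReal.ofReal (gammaGammaPDF α β γbar₂ x))

/-! ### Relay power amplifier -/

/-- The two nonlinear amplifier models: soft envelope limiter and travelling wave tube amplifier
(the latter with negligible AM/PM conversion). -/
inductive Amplifier
  | sel
  | twta

/-- AM/AM characteristic, with input saturation magnitude `A`. -/
def Amplifier.amam (pa : Amplifier) (A r : ℝ) : ℝ :=
  match pa with
  | .sel => if r < A then r else A
  | .twta => A ^ 2 * r / (A ^ 2 + r ^ 2)

/-- Linear scale `δ` of the Bussgang decomposition `ψ = δ φ + d`, with input `φ ∼ CN(0, σ²)` and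
distortion `d` uncorrelated with `φ`; since `ψ` has the phase of `φ`,
`δ = E[ψ φ*] / E|φ|² = E[A_m(|φ|) |φ|] / σ²`. -/
def Amplifier.scale (pa : Amplifier) (A σ : ℝ) : ℝ :=
  (∫ z : ℂ, pa.amam A ‖z‖ * ‖z‖ ∂(complexGaussian (σ ^ 2))) / σ ^ 2

/-- Variance `σ_d² = E|ψ - δ φ|²` of the Bussgang distortion. -/
def Amplifier.distortionVar (pa : Amplifier) (A σ : ℝ) : ℝ :=
  ∫ z : ℂ, (pa.amam A ‖z‖ - pa.scale A σ * ‖z‖) ^ 2 ∂(complexGaussian (σ ^ 2))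

/-- Fixed relaying gain, for the mean channel power `meanPow = E|h_m|²`, the source power `P₁`, the
noise power `σ₀²` and the mean power `σ²` of the relay block. -/
def fixedGain (σ meanPow P₁ σ₀ : ℝ) : ℝ :=
  Real.sqrt (σ ^ 2 / (meanPow * P₁ + σ₀ ^ 2))

/-- `κ = 1 + σ_d² / (δ² G² σ₀²)`. -/
def kappa (pa : Amplifier) (A σ meanPow P₁ σ₀ : ℝ) : ℝ :=
  1 + pa.distortionVar A σ / (pa.scale A σ ^ 2 * fixedGain σ meanPow P₁ σ₀ ^ 2 * σ₀ ^ 2)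

/-! ### IQ imbalance at the destination -/

/-- `ω₁ = (1 + ζ e^{-jθ}) / 2`. -/
def omega1 (ζ θ : ℝ) : ℂ := (1 + ζ * Complex.exp (-(Complex.I * θ))) / 2

/-- `ω₂ = (1 - ζ e^{jθ}) / 2`. -/
def omega2 (ζ θ : ℝ) : ℂ := (1 - ζ * Complex.exp (Complex.I * θ)) / 2

/-- Image-leakage ratio `|ω₂ / ω₁|²`, which vanishes for an ideal destination. -/
def imageLeakageRatio (ζ θ : ℝ) : ℝ := ‖omega2 ζ θ / omega1 ζ θ‖ ^ 2

/-! ### Relay selection and end-to-end quality -/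

/-- Instantaneous first-hop SNR for the gain `h`. -/
def hopSNR (P₁ σ₀ : ℝ) (h : ℂ) : ℝ := P₁ * ‖h‖ ^ 2 / σ₀ ^ 2

/-- Index of the relay whose outdated SNR is the `m`-th smallest. -/
def selectedRelay {N m : ℕ} (hm : 1 ≤ m ∧ m ≤ N) (snr : Fin N → ℝ) : Fin N :=
  Tuple.sort snr ⟨m - 1, by omega⟩

/-- End-to-end signal-to-noise-plus-distortion ratio, for the instantaneous SNRs `x`, `y` of the
two hops and the mean SNR `meanSNR` of the first hop. -/
def sndr (ILR κ meanSNR x y : ℝ) : ℝ :=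
  x * y / (ILR * x * y + (1 + ILR) * κ * y + (1 + ILR) * (meanSNR + κ))

end RelayFSO

end

namespace RelayFSO

/-! ### The complex Gaussian law -/

/-! Condition on the second-hop SNR u of the selected relay. If ILR·γth < 1, the condition SNDR ≥
γth says that the first-hop SNR exceeds a threshold affine in 1/u (`le_sndr_iff`). The selection
looks at outdated RF gains only, so it is independent of the second hop and the selected second-hop
SNR keeps the common marginal (`prod_setOf_selected_mem`). It remains to find the survival function
of the selected current power and to average it over u.

Survival function: given the pair at index l, the number of other relays with smaller outdated SNR
is binomial, so l has rank m with probability C(N-1, m-1) (1-e)^(m-1) e^(N-m), where e =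
exp(-|h̃|²/v) (`pi_setOf_selectedRelay_eq`). After binomial expansion each term carries a weight
exp(-(k-1)|h̃|²/v) with k = N-m+n+1. Such a weight turns CN(0, v) into 1/k times CN(0, v/k), and the
current gain stays circular Gaussian, with variance ((k-1)(1-ρ)+1)v/k; its power is exponential
(`setIntegral_exp_outdatedGainLaw`, `pi_real_setOf_le_selected`).

Average: at the threshold each exponential splits into a constant times exp(-a/u). A Gamma-Gamma SNR
is a scaled squared product of two independent Gamma variables (`gammaGammaSNR_eq_map`), so its
moments are products of Gamma functions. The Mellin transform of a ↦ E[exp(-a/Y)] is Γ(s) E[Y^s];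
Mellin inversion and Legendre duplication identify the function with G^{5,0}_{0,5}
(`integral_exp_neg_div_eq_meijerG`).

If ILR·γth ≥ 1, the SNDR is almost surely below 1/ILR ≤ γth (`sndr_lt`). -/

lemma measurable_ofReal_add_ofReal_mul_I :
    Measurable (fun p : ℝ × ℝ => (p.1 : ℂ) + p.2 * Complex.I) := by fun_prop

instance isProbabilityMeasure_complexGaussian (v : ℝ) :
    IsProbabilityMeasure (complexGaussian v) :=
  Measure.isProbabilityMeasure_map measurable_ofReal_add_ofReal_mul_I.aemeasurable

instance isProbabilityMeasure_outdatedGainLaw (v ρ : ℝ) :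
    IsProbabilityMeasure (outdatedGainLaw v ρ) :=
  Measure.isProbabilityMeasure_map (by fun_prop)

lemma charFun_complexGaussian {v : ℝ} (hv : 0 ≤ v) (t : ℂ) :
    charFun (complexGaussian v) t = Complex.exp (-(v * ‖t‖ ^ 2 / 4 : ℝ)) := by
  rw [charFun_apply, complexGaussian, integral_map (by fun_prop) (by fun_prop)]
  have key : ∀ p : ℝ × ℝ, Complex.exp (inner ℝ ((p.1 : ℂ) + p.2 * Complex.I) t * Complex.I) =
      Complex.exp (t.re * p.1 * Complex.I) * Complex.exp (t.im * p.2 * Complex.I) := by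
    intro p
    rw [← Complex.exp_add, Complex.inner]
    congr 1
    simp
    ring
  simp_rw [key]
  rw [integral_prod_mul (fun x : ℝ => Complex.exp (t.re * x * Complex.I))
    (fun y : ℝ => Complex.exp (t.im * y * Complex.I)), ← charFun_apply_real, ← charFun_apply_real,
    charFun_gaussianReal, charFun_gaussianReal, ← Complex.exp_add]
  congr 1
  rw [Complex.sq_norm, Complex.normSq_apply, Real.coe_toNNReal _ (by positivity)]
  push_cast
  ring

/-- A linear combination of independent circular Gaussian variables is circular Gaussian. -/
lemma map_linearCombination_complexGaussian {a b : ℝ} (ha : 0 ≤ a) (hb : 0 ≤ b) (r s : ℝ) :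
    ((complexGaussian a).prod (complexGaussian b)).map
      (fun p : ℂ × ℂ => (r : ℂ) * p.1 + (s : ℂ) * p.2) =
      complexGaussian (r ^ 2 * a + s ^ 2 * b) := by
  have := Measure.isProbabilityMeasure_map (μ := (complexGaussian a).prod (complexGaussian b))
    (f := fun p : ℂ × ℂ => (r : ℂ) * p.1 + (s : ℂ) * p.2) (by fun_prop)
  -- Characteristic functions need no densities, so vanishing coefficients (ρ = 0 or ρ = 1 later on)
  -- are not special cases.
  apply Measure.ext_of_charFun
  ext t
  rw [charFun_apply, integral_map (by fun_prop) (by fun_prop)]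
  have key : ∀ p : ℂ × ℂ, Complex.exp (inner ℝ ((r : ℂ) * p.1 + (s : ℂ) * p.2) t * Complex.I) =
      Complex.exp (inner ℝ p.1 (r • t) * Complex.I) *
        Complex.exp (inner ℝ p.2 (s • t) * Complex.I) := by
    intro p
    rw [← Complex.exp_add, inner_add_left, ← Complex.real_smul (x := r),
      ← Complex.real_smul (x := s), real_inner_smul_left, real_inner_smul_left,
      real_inner_smul_right, real_inner_smul_right]
    push_cast
    ring_nf
  simp_rw [key]
  rw [integral_prod_mul (fun x : ℂ => Complex.exp (inner ℝ x (r • t) * Complex.I))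
    (fun y : ℂ => Complex.exp (inner ℝ y (s • t) * Complex.I)), ← charFun_apply, ← charFun_apply,
    charFun_complexGaussian ha, charFun_complexGaussian hb, charFun_complexGaussian (by positivity),
    ← Complex.exp_add]
  congr 1
  rw [norm_smul, norm_smul, mul_pow, mul_pow, Real.norm_eq_abs, Real.norm_eq_abs, sq_abs, sq_abs]
  push_cast
  ring

/-- With an explicit radial density, weighting by an exponential of ‖z‖² only changes the variance,
and radial events reduce to one-dimensional integrals. -/
lemma complexGaussian_eq_withDensity {v : ℝ} (hv : 0 < v) :
    complexGaussian v = (volume : Measure ℂ).withDensity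
      (fun z => ENNReal.ofReal ((Real.pi * v)⁻¹ * Real.exp (-(‖z‖ ^ 2 / v)))) := by
  have hv' : (v / 2).toNNReal ≠ 0 := by simpa using hv
  rw [complexGaussian, gaussianReal_of_var_ne_zero _ hv', prod_withDensity (by fun_prop)
    (by fun_prop)]
  have hmp := Complex.volume_preserving_equiv_real_prod.symm
  have hfun : (fun p : ℝ × ℝ => (p.1 : ℂ) + p.2 * Complex.I) =
      ⇑Complex.measurableEquivRealProd.symm := by
    ext p
    simp [Complex.measurableEquivRealProd, Complex.equivRealProdCLM_symm_apply]
  ext s hs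
  rw [hfun, Measure.map_apply Complex.measurableEquivRealProd.symm.measurable hs,
    withDensity_apply _ (Complex.measurableEquivRealProd.symm.measurable hs),
    withDensity_apply _ hs, ← hmp.setLIntegral_comp_preimage hs (by fun_prop)]
  refine lintegral_congr fun p => ?_
  rw [gaussianPDF, gaussianPDF, ← ENNReal.ofReal_mul (gaussianPDFReal_nonneg _ _ _), ← hfun]
  congr 1
  have hn : ‖(p.1 : ℂ) + p.2 * Complex.I‖ ^ 2 = p.1 ^ 2 + p.2 ^ 2 := by
    rw [Complex.sq_norm, Complex.normSq_apply]
    simp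
    ring
  rw [gaussianPDFReal, gaussianPDFReal, hn, Real.coe_toNNReal _ (by positivity),
    mul_mul_mul_comm, ← Real.exp_add, ← mul_inv, Real.mul_self_sqrt (by positivity)]
  congr 2
  · ring
  · field_simp
    ring

/-- Exponential tilting of a circular Gaussian law. -/
lemma withDensity_complexGaussian {v k : ℝ} (hv : 0 < v) (hk : 0 < k) :
    (complexGaussian v).withDensity
      (fun z => ENNReal.ofReal (Real.exp (-((k - 1) * ‖z‖ ^ 2 / v)))) =
      ENNReal.ofReal (1 / k) • complexGaussian (v / k) := by
  rw [complexGaussian_eq_withDensity hv, complexGaussian_eq_withDensity (div_pos hv hk),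
    ← withDensity_mul _ (by fun_prop) (by fun_prop), ← withDensity_smul _ (by fun_prop)]
  congr 1
  ext z
  simp only [Pi.mul_apply, Pi.smul_apply, smul_eq_mul]
  rw [← ENNReal.ofReal_mul (by positivity), ← ENNReal.ofReal_mul (by positivity), mul_assoc,
    ← Real.exp_add, ← mul_assoc]
  congr 2
  · have := Real.pi_pos
    field_simp
  · congr 1
    field_simp
    ring

lemma lintegral_Ioi_mul_exp_neg_sq {v : ℝ} (hv : 0 < v) {a : ℝ} (ha : 0 ≤ a) :
    ∫⁻ r in Set.Ioi a, ENNReal.ofReal (r * Real.exp (-(r ^ 2 / v))) =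
      ENNReal.ofReal (v / 2 * Real.exp (-(a ^ 2 / v))) := by
  have hderiv : ∀ x ∈ Set.Ici a, HasDerivAt (fun r => -(v / 2 * Real.exp (-(r ^ 2 / v))))
      (x * Real.exp (-(x ^ 2 / v))) x := by
    intro x _
    have h : HasDerivAt (fun r : ℝ => -(r ^ 2 / v)) (-(2 * x / v)) x := by
      simpa using ((hasDerivAt_pow 2 x).div_const v).fun_neg
    refine ((h.exp.const_mul (v / 2)).fun_neg).congr_deriv ?_
    field_simp
  have hpos : ∀ x ∈ Set.Ioi a, 0 ≤ x * Real.exp (-(x ^ 2 / v)) := fun x hx =>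
    mul_nonneg (ha.trans (le_of_lt hx)) (Real.exp_pos _).le
  have hlim : Filter.Tendsto (fun r => -(v / 2 * Real.exp (-(r ^ 2 / v)))) Filter.atTop
      (nhds 0) := by
    have h1 : Filter.Tendsto (fun r : ℝ => -(r ^ 2 / v)) Filter.atTop Filter.atBot :=
      Filter.tendsto_neg_atTop_atBot.comp
        ((Filter.tendsto_pow_atTop two_ne_zero).atTop_div_const hv)
    simpa using ((Real.tendsto_exp_atBot.comp h1).const_mul (v / 2)).neg
  rw [← ofReal_integral_eq_lintegral_ofReal (integrableOn_Ioi_deriv_of_nonneg' hderiv hpos hlim)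
    ((ae_restrict_iff' measurableSet_Ioi).2 (.of_forall hpos)),
    integral_Ioi_of_hasDerivAt_of_nonneg' hderiv hpos hlim]
  simp

/-- The power of a circular Gaussian variable is exponentially distributed. -/
lemma complexGaussian_setOf_lt {v : ℝ} (hv : 0 < v) {t : ℝ} (ht : 0 ≤ t) :
    complexGaussian v {z | t < ‖z‖ ^ 2} = ENNReal.ofReal (Real.exp (-(t / v))) := by
  have hs : MeasurableSet {z : ℂ | t < ‖z‖ ^ 2} := measurableSet_lt (by fun_prop) (by fun_prop)
  rw [complexGaussian_eq_withDensity hv, withDensity_apply _ hs, ← lintegral_indicator hs,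
    ← Complex.lintegral_comp_polarCoord_symm]
  have hsq : √t ^ 2 = t := Real.sq_sqrt ht
  -- The event constrains the radius alone, so the integrand is a product and the angle contributes
  -- only its total length.
  have key : ∀ p ∈ polarCoord.target, ENNReal.ofReal p.1 •
      {z : ℂ | t < ‖z‖ ^ 2}.indicator
        (fun z => ENNReal.ofReal ((Real.pi * v)⁻¹ * Real.exp (-(‖z‖ ^ 2 / v))))
        (Complex.polarCoord.symm p) =
      (Set.Ioi √t).indicator (fun r => ENNReal.ofReal (r * Real.exp (-(r ^ 2 / v)))) p.1 *
        (fun _ => ENNReal.ofReal (Real.pi * v)⁻¹) p.2 := by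
    intro p hp
    have hp1 : 0 < p.1 := hp.1
    have hiff : Complex.polarCoord.symm p ∈ {z : ℂ | t < ‖z‖ ^ 2} ↔ p.1 ∈ Set.Ioi √t := by
      rw [Set.mem_ofPred_eq, Complex.norm_polarCoord_symm, sq_abs, Set.mem_Ioi,
        Real.sqrt_lt' hp1]
    by_cases h : p.1 ∈ Set.Ioi √t
    · rw [Set.indicator_of_mem (hiff.2 h), Set.indicator_of_mem h, Complex.norm_polarCoord_symm,
        sq_abs, smul_eq_mul, ← ENNReal.ofReal_mul hp1.le, ← ENNReal.ofReal_mul (by positivity)]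
      ring_nf
    · rw [Set.indicator_of_notMem (fun h' => h (hiff.1 h')), Set.indicator_of_notMem h]
      simp
  rw [setLIntegral_congr_fun polarCoord.open_target.measurableSet key, polarCoord_target,
    Measure.volume_eq_prod, ← Measure.prod_restrict, lintegral_prod_mul
      (f := (Set.Ioi √t).indicator fun r => ENNReal.ofReal (r * Real.exp (-(r ^ 2 / v))))
      (g := fun _ => ENNReal.ofReal (Real.pi * v)⁻¹)
      ((Measurable.indicator (by fun_prop) measurableSet_Ioi).aemeasurable) (by fun_prop),
    setLIntegral_indicator measurableSet_Ioi, Set.inter_eq_left.2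
      (Set.Ioi_subset_Ioi (Real.sqrt_nonneg t)), lintegral_Ioi_mul_exp_neg_sq hv
      (Real.sqrt_nonneg t), hsq, setLIntegral_const, Real.volume_Ioo,
    ← ENNReal.ofReal_mul (by have := Real.pi_pos; positivity),
    ← ENNReal.ofReal_mul (by positivity)]
  congr 1
  have := Real.pi_pos
  field_simp
  ring

/-- Spheres are Lebesgue-null; this is what makes ties between outdated SNRs negligible. -/
lemma complexGaussian_setOf_eq {v : ℝ} (hv : 0 < v) (t : ℝ) :
    complexGaussian v {z | ‖z‖ ^ 2 = t} = 0 := by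
  rw [complexGaussian_eq_withDensity hv]
  refine withDensity_absolutelyContinuous _ _ ?_
  refine measure_mono_null (t := Metric.sphere 0 √t) (fun z (hz : ‖z‖ ^ 2 = t) => ?_)
    (Measure.addHaar_sphere _ _ _)
  rw [mem_sphere_zero_iff_norm, ← hz, Real.sqrt_sq (norm_nonneg z)]

lemma complexGaussian_setOf_le {v : ℝ} (hv : 0 < v) {t : ℝ} (ht : 0 ≤ t) :
    complexGaussian v {z | t ≤ ‖z‖ ^ 2} = ENNReal.ofReal (Real.exp (-(t / v))) := by
  rw [← complexGaussian_setOf_lt hv ht]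
  refine measure_congr ?_
  have h : ∀ᵐ z ∂complexGaussian v, ‖z‖ ^ 2 ≠ t := by
    simpa [ae_iff] using complexGaussian_setOf_eq hv t
  filter_upwards [h] with z hz
  exact propext ⟨fun hle => lt_of_le_of_ne hle hz.symm, fun hlt => le_of_lt hlt⟩

/-- Exponential moments of the outdated power on the event that the current power exceeds `t`. -/
lemma setIntegral_exp_outdatedGainLaw {v ρ k t : ℝ} (hv : 0 < v) (hρ : 0 ≤ ρ ∧ ρ ≤ 1)
    (hk : 1 ≤ k) (ht : 0 ≤ t) :
    ∫ p in {p : ℂ × ℂ | t ≤ ‖p.2‖ ^ 2}, Real.exp (-((k - 1) * ‖p.1‖ ^ 2 / v))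
      ∂outdatedGainLaw v ρ =
      1 / k * Real.exp (-(k * t / (((k - 1) * (1 - ρ) + 1) * v))) := by
  have hk0 : 0 < k := by linarith
  have hd : 0 < (k - 1) * (1 - ρ) + 1 := by
    have := mul_nonneg (sub_nonneg.2 hk) (sub_nonneg.2 hρ.2)
    linarith
  set T : ℂ × ℂ → ℂ := fun p => ((√ρ : ℝ) : ℂ) * p.1 + ((√(1 - ρ) : ℝ) : ℂ) * p.2 with hT
  have hTm : Measurable T := by fun_prop
  have hs : MeasurableSet {z : ℂ | t ≤ ‖z‖ ^ 2} := measurableSet_le (by fun_prop) (by fun_prop)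
  have hs2 : MeasurableSet {p : ℂ × ℂ | t ≤ ‖p.2‖ ^ 2} :=
    measurableSet_le (by fun_prop) (by fun_prop)
  rw [integral_eq_lintegral_of_nonneg_ae (.of_forall fun _ => (Real.exp_pos _).le)
    (by fun_prop), outdatedGainLaw, setLIntegral_map hs2 (by fun_prop) (by fun_prop)]
  have hpre : (fun p : ℂ × ℂ => (p.1, ((√ρ : ℝ) : ℂ) * p.1 + ((√(1 - ρ) : ℝ) : ℂ) * p.2)) ⁻¹'
      {p : ℂ × ℂ | t ≤ ‖p.2‖ ^ 2} = T ⁻¹' {z | t ≤ ‖z‖ ^ 2} := rfl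
  -- The weight depends on the outdated gain only: absorbed into that factor, it replaces CN(0, v)
  -- by 1/k times CN(0, v/k), and the current gain is then a linear combination of independent
  -- circular Gaussians.
  rw [hpre, ← withDensity_apply _ (hTm hs), ← prod_withDensity_left
      (f := fun z : ℂ => ENNReal.ofReal (Real.exp (-((k - 1) * ‖z‖ ^ 2 / v)))) (by fun_prop),
    withDensity_complexGaussian hv hk0, Measure.prod_smul_left, Measure.smul_apply,
    ← Measure.map_apply hTm hs, hT,
    map_linearCombination_complexGaussian (by positivity) hv.le, Real.sq_sqrt hρ.1,
    Real.sq_sqrt (sub_nonneg.2 hρ.2)]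
  have hvar : ρ * (v / k) + (1 - ρ) * v = ((k - 1) * (1 - ρ) + 1) * v / k := by
    field_simp
    ring
  rw [hvar, complexGaussian_setOf_le (by positivity) ht, smul_eq_mul,
    ← ENNReal.ofReal_mul (by positivity), ENNReal.toReal_ofReal (by positivity)]
  congr 3
  field_simp

/-! ### Order statistics -/

/-- The relay of rank `m` is the one preceded by `m - 1` others, ties being broken by index. -/
lemma selectedRelay_eq_iff {N m : ℕ} (hm : 1 ≤ m ∧ m ≤ N) (f : Fin N → ℝ) (l : Fin N) :
    selectedRelay hm f = l ↔
      (Finset.univ.filter fun j => f j < f l ∨ f j = f l ∧ j < l).card = m - 1 := by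
  set σ := Tuple.sort f with hσ
  obtain ⟨hmono, htie⟩ := Tuple.eq_sort_iff.1 hσ
  have hcard : ∀ i : Fin N,
      (Finset.univ.filter fun j => f j < f (σ i) ∨ f j = f (σ i) ∧ j < σ i).card = i := by
    intro i
    -- The sort lists indices in lexicographic order of (value, index), so the predecessors of `σ i`
    -- are the images of the positions below `i`.
    have : (Finset.univ.filter fun j => f j < f (σ i) ∨ f j = f (σ i) ∧ j < σ i) =
        (Finset.Iio i).map σ.toEmbedding := by
      ext j
      obtain ⟨k, rfl⟩ := σ.surjective j
      simp only [Finset.mem_filter, Finset.mem_univ, true_and, Finset.mem_map_equiv,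
        Equiv.symm_apply_apply, Finset.mem_Iio]
      constructor
      · rintro (h | ⟨h1, h2⟩)
        · by_contra hle
          exact absurd (hmono (not_lt.1 hle)) (not_le.2 h)
        · rcases lt_trichotomy k i with h | rfl | h
          · exact h
          · exact absurd h2 (lt_irrefl _)
          · exact absurd (htie i k h h1.symm) (not_lt.2 h2.le)
      · intro h
        rcases (hmono h.le).lt_or_eq with h' | h'
        · exact Or.inl h'
        · exact Or.inr ⟨h', htie k i h h'⟩
    rw [this, Finset.card_map, Fin.card_Iio]
  obtain ⟨i, rfl⟩ := σ.surjective l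
  rw [hcard, selectedRelay, ← hσ, σ.apply_eq_iff_eq, Fin.ext_iff]
  exact eq_comm

/-- The counting description of the rank makes each fibre a level set of a finite sum of indicators,
and there are finitely many fibres. -/
lemma measurable_selectedRelay {N m : ℕ} (hm : 1 ≤ m ∧ m ≤ N) :
    Measurable (selectedRelay hm) := by
  refine measurable_to_countable' fun l => ?_
  have : selectedRelay hm ⁻¹' {l} = {f | ∑ j, Set.indicator
      {f : Fin N → ℝ | f j < f l ∨ f j = f l ∧ j < l} (fun _ => 1) f = m - 1} := by
    ext f
    rw [Set.mem_preimage, Set.mem_singleton_iff, selectedRelay_eq_iff, Finset.card_filter]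
    simp [Set.indicator_apply]
  rw [this]
  refine measurableSet_eq_fun (Finset.measurable_sum _ fun j _ => ?_) measurable_const
  refine measurable_const.indicator ?_
  have h1 : MeasurableSet {f : Fin N → ℝ | f j < f l} :=
    measurableSet_lt (measurable_pi_apply j) (measurable_pi_apply l)
  have h2 : MeasurableSet {f : Fin N → ℝ | f j = f l} :=
    measurableSet_eq_fun (measurable_pi_apply j) (measurable_pi_apply l)
  exact h1.union (h2.inter (MeasurableSet.const _))

open Classical in
/-- The number of successes in independent trials of equal success probability is binomial. -/
lemma pi_setOf_card_filter_mem_eq {ι E : Type*} [Fintype ι] [MeasurableSpace E] (μ : Measure E)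
    [IsProbabilityMeasure μ] (T : ι → Set E) (hT : ∀ j, MeasurableSet (T j)) (p : ENNReal)
    (hp : ∀ j, μ (T j) = p) (k : ℕ) :
    Measure.pi (fun _ : ι => μ) {y | (Finset.univ.filter fun j => y j ∈ T j).card = k} =
      (Fintype.card ι).choose k * (p ^ k * (1 - p) ^ (Fintype.card ι - k)) := by
  -- Partition by the exact set `S` of successes: each cell is a box, and all boxes have the same
  -- measure.
  have hset : {y : ι → E | (Finset.univ.filter fun j => y j ∈ T j).card = k} =
      ⋃ S ∈ Finset.powersetCard k (Finset.univ : Finset ι),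
        Set.univ.pi fun j => if j ∈ S then T j else (T j)ᶜ := by
    ext y
    simp only [Set.mem_ofPred_eq, Set.mem_iUnion, Finset.mem_powersetCard_univ, exists_prop,
      Set.mem_univ_pi]
    constructor
    · intro h
      refine ⟨_, h, fun j => ?_⟩
      by_cases hj : y j ∈ T j <;> simp [hj]
    · rintro ⟨S, hS, hy⟩
      rw [← hS]
      congr 1
      ext j
      have := hy j
      by_cases hj : j ∈ S <;> simp_all
  rw [hset, measure_biUnion_finset]
  · rw [Finset.sum_congr rfl (g := fun _ => p ^ k * (1 - p) ^ (Fintype.card ι - k)),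
      Finset.sum_const, Finset.card_powersetCard, nsmul_eq_mul, Finset.card_univ]
    intro S hS
    rw [Finset.mem_powersetCard_univ] at hS
    have hprod : ∀ j, μ (if j ∈ S then T j else (T j)ᶜ) = if j ∈ S then p else 1 - p := by
      intro j
      split_ifs
      · exact hp j
      · rw [prob_compl_eq_one_sub (hT j), hp j]
    rw [Measure.pi_pi, Finset.prod_congr rfl fun j _ => hprod j, Finset.prod_ite,
      Finset.prod_const, Finset.prod_const, Finset.filter_mem_eq_inter, Finset.univ_inter,
      Finset.filter_not, Finset.filter_mem_eq_inter, Finset.univ_inter,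
      ← Finset.compl_eq_univ_sdiff, Finset.card_compl, hS]
  · intro S _ S' _ hne
    refine Set.disjoint_left.2 fun y hy hy' => hne ?_
    ext j
    have h1 := hy j (Set.mem_univ j)
    have h2 := hy' j (Set.mem_univ j)
    by_cases hj : j ∈ S <;> by_cases hj' : j ∈ S' <;> simp_all
  · intro S _
    refine MeasurableSet.univ_pi fun j => ?_
    split_ifs
    exacts [hT j, (hT j).compl]

/-- Law of the selected entry of an i.i.d. family, on the event that it has index `l`. -/
lemma pi_setOf_selectedRelay_eq {E : Type*} [MeasurableSpace E] (μ : Measure E)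
    [IsProbabilityMeasure μ] {f : E → ℝ} (hf : Measurable f) (hties : ∀ c, μ {b | f b = c} = 0)
    {N m : ℕ} (hm : 1 ≤ m ∧ m ≤ N) (l : Fin N) {B : Set E} (hB : MeasurableSet B) :
    Measure.pi (fun _ : Fin N => μ) {x | selectedRelay hm (fun j => f (x j)) = l ∧ x l ∈ B} =
      ∫⁻ a in B, ((N - 1).choose (m - 1) : ENNReal) *
        (μ {b | f b < f a} ^ (m - 1) * (1 - μ {b | f b < f a}) ^ (N - m)) ∂μ := by
  obtain ⟨n, rfl⟩ : ∃ n, N = n + 1 := ⟨N - 1, by omega⟩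
  -- The values at index `l.succAbove j` that precede the value `a` at index `l`. The tie clause
  -- depends on `j` but is null, so all these sets have the same probability.
  set T : E → Fin n → Set E := fun a j => {b | f b < f a ∨ f b = f a ∧ l.succAbove j < l} with hTdef
  have hT : ∀ a j, MeasurableSet (T a j) := fun a j =>
    (measurableSet_lt hf measurable_const).union
      ((measurableSet_eq_fun hf measurable_const).inter (MeasurableSet.const _))
  have hTp : ∀ a j, μ (T a j) = μ {b | f b < f a} := by
    intro a j
    refine measure_congr ?_
    have h : ∀ᵐ b ∂μ, f b ≠ f a := by simpa [ae_iff] using hties (f a)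
    filter_upwards [h] with b hb
    exact propext ⟨fun h => h.resolve_right fun h' => hb h'.1, fun h => Or.inl h⟩
  classical
  have hmeasF : Measurable fun x : Fin (n + 1) → E => selectedRelay hm (fun j => f (x j)) :=
    (measurable_selectedRelay hm).comp
      (measurable_pi_lambda _ fun j => hf.comp (measurable_pi_apply j))
  set A : Set (E × (Fin n → E)) :=
    {q | (Finset.univ.filter fun j => q.2 j ∈ T q.1 j).card = m - 1 ∧ q.1 ∈ B} with hA
  -- Coordinate `l` never precedes itself, so its rank is a count over the other `n` coordinates,
  -- which are independent of it.
  have hpre : {x : Fin (n + 1) → E | selectedRelay hm (fun j => f (x j)) = l ∧ x l ∈ B} =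
      MeasurableEquiv.piFinSuccAbove (fun _ => E) l ⁻¹' A := by
    ext x
    rw [Set.mem_ofPred_eq, selectedRelay_eq_iff, Fin.univ_succAbove _ l,
      Finset.filter_cons_of_neg _ _ _ _ (by simp), Finset.filter_map, Finset.card_map]
    rfl
  have hAm : MeasurableSet A := by
    rw [← MeasurableEquiv.measurableSet_preimage
      (MeasurableEquiv.piFinSuccAbove (fun _ => E) l), ← hpre]
    exact (hmeasF (measurableSet_singleton l)).inter (measurable_pi_apply l hB)
  rw [hpre, (measurePreserving_piFinSuccAbove (fun _ => μ) l).measure_preimage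
    hAm.nullMeasurableSet, Measure.prod_apply hAm, ← lintegral_indicator hB]
  refine lintegral_congr fun a => ?_
  by_cases ha : a ∈ B
  · rw [Set.indicator_of_mem ha]
    have : Prod.mk a ⁻¹' A = {y | (Finset.univ.filter fun j => y j ∈ T a j).card = m - 1} := by
      ext y
      simp [hA, ha]
    have hcard := pi_setOf_card_filter_mem_eq μ (T a) (hT a) _ (hTp a) (m - 1)
    rw [Fintype.card_fin] at hcard
    rw [this, Nat.add_sub_cancel, show n + 1 - m = n - (m - 1) by omega, ← hcard]
    congr!
  · rw [Set.indicator_of_notMem ha]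
    have : Prod.mk a ⁻¹' A = ∅ := by
      ext y
      simp [hA, ha]
    rw [this, measure_empty]

/-! ### Selection by outdated SNR and the current gain of the selected relay. -/

lemma map_fst_outdatedGainLaw (v ρ : ℝ) :
    (outdatedGainLaw v ρ).map Prod.fst = complexGaussian v := by
  rw [outdatedGainLaw, Measure.map_map (by fun_prop) (by fun_prop)]
  exact (measurePreserving_fst (μ := complexGaussian v) (ν := complexGaussian v)).map_eq

lemma outdatedGainLaw_setOf_hopSNR_eq {v ρ P₁ σ₀ : ℝ} (hv : 0 < v) (hP₁ : 0 < P₁) (hσ₀ : 0 < σ₀)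
    (c : ℝ) : outdatedGainLaw v ρ {p | hopSNR P₁ σ₀ p.1 = c} = 0 := by
  have h := complexGaussian_setOf_eq hv (c * σ₀ ^ 2 / P₁)
  rw [← map_fst_outdatedGainLaw v ρ, Measure.map_apply (by fun_prop)
    (measurableSet_eq_fun (by fun_prop) (by fun_prop))] at h
  refine measure_mono_null (fun p hp => ?_) h
  have hp : hopSNR P₁ σ₀ p.1 = c := hp
  change ‖p.1‖ ^ 2 = c * σ₀ ^ 2 / P₁
  rw [← hp, hopSNR]
  field_simp

lemma outdatedGainLaw_setOf_hopSNR_lt {v ρ P₁ σ₀ : ℝ} (hv : 0 < v) (hP₁ : 0 < P₁) (hσ₀ : 0 < σ₀)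
    (z : ℂ) : outdatedGainLaw v ρ {p | hopSNR P₁ σ₀ p.1 < hopSNR P₁ σ₀ z} =
      1 - ENNReal.ofReal (Real.exp (-(‖z‖ ^ 2 / v))) := by
  have hs : MeasurableSet {w : ℂ | ‖z‖ ^ 2 ≤ ‖w‖ ^ 2} :=
    measurableSet_le (by fun_prop) (by fun_prop)
  rw [← complexGaussian_setOf_le hv (sq_nonneg ‖z‖), ← prob_compl_eq_one_sub hs,
    ← map_fst_outdatedGainLaw v ρ, Measure.map_apply (by fun_prop) hs.compl]
  congr 1
  ext p
  change P₁ * ‖p.1‖ ^ 2 / σ₀ ^ 2 < P₁ * ‖z‖ ^ 2 / σ₀ ^ 2 ↔ ¬ ‖z‖ ^ 2 ≤ ‖p.1‖ ^ 2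
  rw [div_lt_div_iff_of_pos_right (by positivity), mul_lt_mul_iff_right₀ hP₁, not_le]

lemma measurable_hopSNR (P₁ σ₀ : ℝ) : Measurable (hopSNR P₁ σ₀) := by
  unfold hopSNR
  fun_prop

/-- Survival function of the power of the current gain of the selected relay. -/
lemma pi_real_setOf_le_selected {v ρ P₁ σ₀ t : ℝ} (hv : 0 < v) (hρ : 0 ≤ ρ ∧ ρ ≤ 1)
    (hP₁ : 0 < P₁) (hσ₀ : 0 < σ₀) (ht : 0 ≤ t) {N m : ℕ} (hm : 1 ≤ m ∧ m ≤ N) :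
    (Measure.pi (fun _ : Fin N => outdatedGainLaw v ρ)).real
      {x | t ≤ ‖(x (selectedRelay hm fun j => hopSNR P₁ σ₀ (x j).1)).2‖ ^ 2} =
    m * N.choose m * ∑ n ∈ Finset.range m,
      (m - 1).choose n * ((-1) ^ n / ((N : ℝ) - m + n + 1)) *
        Real.exp (-(((N : ℝ) - m + n + 1) * t / ((((N : ℝ) - m + n) * (1 - ρ) + 1) * v))) := by
  set μ := outdatedGainLaw v ρ with hμ
  set f : ℂ × ℂ → ℝ := fun p => hopSNR P₁ σ₀ p.1 with hf
  have hfm : Measurable f := (measurable_hopSNR P₁ σ₀).comp measurable_fst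
  set B : Set (ℂ × ℂ) := {p | t ≤ ‖p.2‖ ^ 2} with hBdef
  have hB : MeasurableSet B := measurableSet_le (by fun_prop) (by fun_prop)
  set sel : (Fin N → ℂ × ℂ) → Fin N := fun x => selectedRelay hm fun j => f (x j) with hsel
  have hselm : Measurable sel := (measurable_selectedRelay hm).comp
    (measurable_pi_lambda _ fun j => hfm.comp (measurable_pi_apply j))
  have hunion : {x : Fin N → ℂ × ℂ | t ≤ ‖(x (sel x)).2‖ ^ 2} =
      ⋃ l ∈ (Finset.univ : Finset (Fin N)), {x | sel x = l ∧ x l ∈ B} := by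
    ext x
    simp [hBdef]
  have hterm : ∀ l : Fin N, (Measure.pi fun _ : Fin N => μ).real {x | sel x = l ∧ x l ∈ B} =
      ∫ p in B, ((N - 1).choose (m - 1) : ℝ) * ((1 - Real.exp (-(‖p.1‖ ^ 2 / v))) ^ (m - 1) *
        Real.exp (-(‖p.1‖ ^ 2 / v)) ^ (N - m)) ∂μ := by
    intro l
    have hle : ∀ p : ℂ × ℂ, Real.exp (-(‖p.1‖ ^ 2 / v)) ≤ 1 := fun p =>
      Real.exp_le_one_iff.2 (neg_nonpos.2 (by positivity))
    rw [measureReal_def, pi_setOf_selectedRelay_eq μ hfm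
      (outdatedGainLaw_setOf_hopSNR_eq hv hP₁ hσ₀) hm l hB, integral_eq_lintegral_of_nonneg_ae]
    · congr 1
      refine lintegral_congr fun p => ?_
      rw [hf, outdatedGainLaw_setOf_hopSNR_lt hv hP₁ hσ₀, ← ENNReal.ofReal_one,
        ← ENNReal.ofReal_sub _ (Real.exp_pos _).le, ← ENNReal.ofReal_sub _ (sub_nonneg.2 (hle p)),
        sub_sub_cancel, ← ENNReal.ofReal_pow (sub_nonneg.2 (hle p)),
        ← ENNReal.ofReal_pow (Real.exp_pos _).le,
        ← ENNReal.ofReal_mul (pow_nonneg (sub_nonneg.2 (hle p)) _), ENNReal.ofReal_mul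
        (Nat.cast_nonneg _), ENNReal.ofReal_natCast]
    · refine .of_forall fun p => ?_
      have := sub_nonneg.2 (hle p)
      positivity
    · fun_prop
  change (Measure.pi (fun _ : Fin N => μ)).real {x | t ≤ ‖(x (sel x)).2‖ ^ 2} = _
  rw [hunion, measureReal_biUnion_finset]
  · simp_rw [hterm]
    -- Expand (1-e)^(m-1). The resulting power n + (N-m) of e is written k - 1 with k = N-m+n+1, the
    -- form of `setIntegral_exp_outdatedGainLaw`.
    have hexp : ∀ p : ℂ × ℂ, ((N - 1).choose (m - 1) : ℝ) *
        ((1 - Real.exp (-(‖p.1‖ ^ 2 / v))) ^ (m - 1) * Real.exp (-(‖p.1‖ ^ 2 / v)) ^ (N - m)) =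
        ∑ n ∈ Finset.range m, ((N - 1).choose (m - 1) : ℝ) * ((m - 1).choose n * (-1) ^ n) *
          Real.exp (-((((N : ℝ) - m + n + 1) - 1) * ‖p.1‖ ^ 2 / v)) := by
      intro p
      set e := Real.exp (-(‖p.1‖ ^ 2 / v)) with he
      have hr : ∀ n : ℕ, Real.exp (-((((N : ℝ) - m + n + 1) - 1) * ‖p.1‖ ^ 2 / v)) =
          e ^ n * e ^ (N - m) := by
        intro n
        rw [he, ← pow_add, ← Real.exp_nat_mul]
        push_cast [Nat.cast_sub hm.2]
        ring_nf
      simp_rw [hr]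
      rw [sub_eq_neg_add, add_pow, Nat.sub_add_cancel hm.1, Finset.sum_mul, Finset.mul_sum]
      refine Finset.sum_congr rfl fun n _ => ?_
      rw [neg_pow, one_pow]
      ring
    simp_rw [hexp]
    have hint : ∀ n : ℕ, Integrable (fun p : ℂ × ℂ =>
        Real.exp (-((((N : ℝ) - m + n + 1) - 1) * ‖p.1‖ ^ 2 / v))) (μ.restrict B) := by
      intro n
      refine Integrable.of_bound (by fun_prop) 1 (.of_forall fun p => ?_)
      have hmN : (m : ℝ) ≤ N := by exact_mod_cast hm.2
      rw [Real.norm_eq_abs, Real.abs_exp, Real.exp_le_one_iff, neg_nonpos]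
      refine div_nonneg (mul_nonneg ?_ (sq_nonneg _)) hv.le
      have : (0 : ℝ) ≤ n := Nat.cast_nonneg n
      linarith
    rw [integral_finsetSum _ fun n _ => (hint n).const_mul _, Finset.sum_const, Finset.card_univ,
      Fintype.card_fin, nsmul_eq_mul, Finset.mul_sum, Finset.mul_sum]
    -- The factor `N` counts the equally likely values of the selected index.
    have hchoose : (N : ℝ) * (N - 1).choose (m - 1) = m * N.choose m := by
      obtain ⟨a, rfl⟩ : ∃ a, N = a + 1 := ⟨N - 1, by omega⟩
      obtain ⟨b, rfl⟩ : ∃ b, m = b + 1 := ⟨m - 1, by omega⟩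
      have := Nat.add_one_mul_choose_eq a b
      rw [Nat.add_sub_cancel, Nat.add_sub_cancel, mul_comm ((b + 1 : ℕ) : ℝ)]
      exact_mod_cast this
    refine Finset.sum_congr rfl fun n _ => ?_
    have hk : (1 : ℝ) ≤ (N : ℝ) - m + n + 1 := by
      have hmN : (m : ℝ) ≤ N := by exact_mod_cast hm.2
      have : (0 : ℝ) ≤ n := Nat.cast_nonneg n
      linarith
    rw [integral_const_mul, setIntegral_exp_outdatedGainLaw hv hρ hk ht, ← hchoose,
      add_sub_cancel_right]
    ring
  · intro l _ l' _ hne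
    exact Set.disjoint_left.2 fun x hx hx' => hne (hx.1.symm.trans hx'.1)
  · intro l _
    have hl : MeasurableSet {x : Fin N → ℂ × ℂ | x l ∈ B} := measurable_pi_apply l hB
    exact (hselm (measurableSet_singleton l)).inter hl

/-! ### The Gamma-Gamma law as the law of a product -/

/-- Half of the quadratic lower bound for exp |t|; it lets a Gaussian dominate the Bessel integrand.
-/
lemma sq_div_four_le_cosh (t : ℝ) : t ^ 2 / 4 ≤ Real.cosh t := by
  rw [← Real.cosh_abs, Real.cosh_eq, ← sq_abs]
  have h1 := Real.quadratic_le_exp_of_nonneg (abs_nonneg t)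
  have h2 := Real.exp_pos (-|t|)
  have h3 := abs_nonneg t
  linarith

lemma integrable_exp_neg_mul_cosh_add {x : ℝ} (hx : 0 < x) (ν : ℝ) :
    Integrable fun t : ℝ => Real.exp (-x * Real.cosh t + ν * t) := by
  refine ((integrable_exp_neg_mul_sq (b := x / 8) (by positivity)).const_mul
    (Real.exp (2 * ν ^ 2 / x))).mono' (by fun_prop) (.of_forall fun t => ?_)
  rw [Real.norm_eq_abs, Real.abs_exp, ← Real.exp_add, Real.exp_le_exp]
  have h1 := mul_le_mul_of_nonneg_left (sq_div_four_le_cosh t) hx.le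
  -- Completing the square: half of the available decay x·t²/4 absorbs the linear term.
  have h2 : ν * t ≤ x * t ^ 2 / 8 + 2 * ν ^ 2 / x := by
    have h3 : x * t ^ 2 / 8 + 2 * ν ^ 2 / x - ν * t = (x * t - 4 * ν) ^ 2 / (8 * x) := by
      field_simp
      ring
    have h4 : 0 ≤ (x * t - 4 * ν) ^ 2 / (8 * x) := by positivity
    linarith
  linarith

/-- The integrand is even, and over the whole line both exponentials in cosh(νt) contribute equally.
A single exponential is what later factors into two log-Gamma densities. -/
lemma besselK_eq_integral {x : ℝ} (hx : 0 < x) (ν : ℝ) :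
    besselK ν x = 1 / 2 * ∫ t : ℝ, Real.exp (-x * Real.cosh t + ν * t) := by
  have hint := integrable_exp_neg_mul_cosh_add hx ν
  have hneg : ∫ t : ℝ, Real.exp (-x * Real.cosh t + ν * -t) =
      ∫ t : ℝ, Real.exp (-x * Real.cosh t + ν * t) := by
    rw [← integral_neg_eq_self (fun t : ℝ => Real.exp (-x * Real.cosh t + ν * t))]
    simp_rw [Real.cosh_neg]
  have hint' : Integrable fun t : ℝ => Real.exp (-x * Real.cosh t + ν * -t) := by
    simpa using integrable_exp_neg_mul_cosh_add hx (-ν)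
  have h := integral_comp_abs (f := fun t => Real.exp (-x * Real.cosh t) * Real.cosh (ν * t))
  have habs : ∀ t : ℝ, Real.exp (-x * Real.cosh |t|) * Real.cosh (ν * |t|) =
      1 / 2 * (Real.exp (-x * Real.cosh t + ν * t) + Real.exp (-x * Real.cosh t + ν * -t)) := by
    intro t
    have : Real.cosh (ν * |t|) = Real.cosh (ν * t) := by
      rw [← Real.cosh_abs, abs_mul, abs_abs, ← abs_mul, Real.cosh_abs]
    rw [Real.cosh_abs, this, Real.cosh_eq (ν * t), Real.exp_add, Real.exp_add, mul_neg]
    ring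
  simp_rw [habs] at h
  rw [integral_const_mul, integral_add hint hint', hneg] at h
  rw [besselK]
  linarith

lemma ofReal_besselK {x : ℝ} (hx : 0 < x) (ν : ℝ) :
    ENNReal.ofReal (2 * besselK ν x) =
      ∫⁻ t : ℝ, ENNReal.ofReal (Real.exp (-x * Real.cosh t + ν * t)) := by
  rw [besselK_eq_integral hx, ← ofReal_integral_eq_lintegral_ofReal
    (integrable_exp_neg_mul_cosh_add hx ν) (.of_forall fun _ => (Real.exp_pos _).le)]
  congr 1
  ring

/-- Exponential substitution in an integral over the half-line. -/
lemma lintegral_Ioi_eq_lintegral_exp {c k : ℝ} (hc : 0 < c) (hk : 0 < k) (h : ℝ → ENNReal) :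
    ∫⁻ y in Set.Ioi 0, h y =
      ∫⁻ u, ENNReal.ofReal (k * (c * Real.exp (k * u))) * h (c * Real.exp (k * u)) := by
  have himage : (fun u : ℝ => c * Real.exp (k * u)) '' Set.univ = Set.Ioi 0 := by
    ext y
    simp only [Set.image_univ, Set.mem_range, Set.mem_Ioi]
    constructor
    · rintro ⟨u, rfl⟩
      positivity
    · intro hy
      refine ⟨Real.log (y / c) / k, ?_⟩
      rw [mul_div_cancel₀ _ hk.ne', Real.exp_log (div_pos hy hc)]
      field_simp
  have hderiv : ∀ u ∈ Set.univ, HasDerivWithinAt (fun u : ℝ => c * Real.exp (k * u))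
      (k * (c * Real.exp (k * u))) Set.univ u := by
    intro u _
    have h1 : HasDerivAt (fun u : ℝ => k * u) k u := by
      simpa using (hasDerivAt_id u).const_mul k
    exact ((h1.exp.const_mul c).congr_deriv (by ring)).hasDerivWithinAt
  have hinj : Set.InjOn (fun u : ℝ => c * Real.exp (k * u)) Set.univ := by
    intro u _ u' _ huu'
    have := Real.exp_injective (mul_left_cancel₀ hc.ne' huu')
    exact mul_left_cancel₀ hk.ne' this
  rw [← himage, lintegral_image_eq_lintegral_abs_deriv_mul MeasurableSet.univ hderiv hinj,
    Measure.restrict_univ]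
  refine lintegral_congr fun u => ?_
  rw [abs_of_pos (by positivity)]

/-- Density of the logarithm of a Gamma variable. -/
noncomputable def logGammaPDF (a t : ℝ) : ℝ := Real.exp (a * t - Real.exp t) / Real.Gamma a

lemma measurable_logGammaPDF (a : ℝ) : Measurable (logGammaPDF a) := by
  unfold logGammaPDF
  fun_prop

lemma logGammaPDF_nonneg {a : ℝ} (ha : 0 < a) (t : ℝ) : 0 ≤ logGammaPDF a t :=
  div_nonneg (Real.exp_pos _).le (Real.Gamma_pos_of_pos ha).le

lemma gammaMeasure_one_eq_withDensity (a : ℝ) : gammaMeasure a 1 =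
    (volume.restrict (Set.Ioi 0)).withDensity
      (fun x => ENNReal.ofReal ((Real.Gamma a)⁻¹ * (x ^ (a - 1) * Real.exp (-x)))) := by
  rw [gammaMeasure, ← withDensity_indicator measurableSet_Ioi]
  refine withDensity_congr_ae ?_
  filter_upwards [Measure.ae_ne volume (0 : ℝ)] with x hx
  rcases lt_or_gt_of_ne hx with h | h
  · rw [gammaPDF_of_neg h, Set.indicator_of_notMem (by simpa using h.le)]
  · rw [gammaPDF_of_nonneg h.le, Set.indicator_of_mem (Set.mem_Ioi.2 h), Real.one_rpow, one_mul, one_div,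
      mul_assoc]

lemma lintegral_gammaMeasure_one {a : ℝ} {h : ℝ → ENNReal} (hh : Measurable h) :
    ∫⁻ x, h x ∂gammaMeasure a 1 =
      ∫⁻ t, ENNReal.ofReal (logGammaPDF a t) * h (Real.exp t) := by
  rw [gammaMeasure_one_eq_withDensity, lintegral_withDensity_eq_lintegral_mul _ (by fun_prop) hh,
    lintegral_Ioi_eq_lintegral_exp one_pos one_pos]
  refine lintegral_congr fun t => ?_
  rw [Pi.mul_apply, ← mul_assoc, ← ENNReal.ofReal_mul (by positivity), one_mul, one_mul, one_mul,
    logGammaPDF, ← Real.exp_mul, mul_left_comm, ← Real.exp_add, ← Real.exp_add]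
  congr 2
  rw [inv_mul_eq_div]
  congr 2
  ring

instance sFinite_gammaMeasure (a r : ℝ) : SFinite (gammaMeasure a r) := by
  unfold gammaMeasure
  infer_instance

/-- The substitution y = γbar₂/(αβ)²·exp(2u) is scaled so that αβ√(y/γbar₂) = exp u, which removes
all scale parameters; 2y is its Jacobian. -/
lemma gammaGammaPDF_exp {α β γbar₂ : ℝ} (hα : 0 < α) (hβ : 0 < β) (hγ : 0 < γbar₂) (u : ℝ) :
    2 * (γbar₂ / (α * β) ^ 2 * Real.exp (2 * u)) *
        gammaGammaPDF α β γbar₂ (γbar₂ / (α * β) ^ 2 * Real.exp (2 * u)) =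
      Real.exp ((α + β) / 2 * u) / (Real.Gamma α * Real.Gamma β) *
        (2 * besselK (α - β) (2 * Real.exp (u / 2))) := by
  have hαβ : 0 < α * β := mul_pos hα hβ
  have hΓα := Real.Gamma_pos_of_pos hα
  have hΓβ := Real.Gamma_pos_of_pos hβ
  set y := γbar₂ / (α * β) ^ 2 * Real.exp (2 * u) with hy
  have hypos : 0 < y := by positivity
  have hexp : Real.exp (2 * u) = Real.exp u ^ 2 := by rw [← Real.exp_nat_mul]; norm_num
  have hratio : y / γbar₂ = (Real.exp u / (α * β)) ^ 2 := by
    rw [hy, hexp]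
    field_simp
  have harg : √(α * β * √(y / γbar₂)) = Real.exp (u / 2) := by
    rw [hratio, Real.sqrt_sq (by positivity), mul_div_cancel₀ _ hαβ.ne', Real.sqrt_eq_rpow,
      ← Real.exp_mul]
    ring_nf
  have hpow : (α * β) ^ ((α + β) / 2) * y ^ ((α + β) / 4) / γbar₂ ^ ((α + β) / 4) =
      Real.exp ((α + β) / 2 * u) := by
    rw [mul_div_assoc, ← Real.div_rpow hypos.le hγ.le, hratio, ← Real.rpow_natCast,
      ← Real.rpow_mul (by positivity), show ((2 : ℕ) : ℝ) * ((α + β) / 4) = (α + β) / 2 by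
        push_cast; ring, ← Real.mul_rpow hαβ.le (by positivity), mul_div_cancel₀ _ hαβ.ne',
      ← Real.exp_mul, mul_comm]
  have hg : 0 < γbar₂ ^ ((α + β) / 4) := Real.rpow_pos_of_pos hγ _
  rw [gammaGammaPDF, harg, Real.rpow_sub_one hypos.ne', ← hpow]
  field_simp

/-- Since exp(u/2+t) + exp(u/2-t) = 2 exp(u/2) cosh t, the Bessel integral is, up to a shift of t,
the convolution of two log-Gamma densities, i.e. the density of the logarithm of a product. -/
lemma ofReal_gammaGammaPDF_exp {α β γbar₂ : ℝ} (hα : 0 < α) (hβ : 0 < β) (hγ : 0 < γbar₂)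
    (u : ℝ) :
    ENNReal.ofReal (2 * (γbar₂ / (α * β) ^ 2 * Real.exp (2 * u))) *
        ENNReal.ofReal (gammaGammaPDF α β γbar₂ (γbar₂ / (α * β) ^ 2 * Real.exp (2 * u))) =
      ∫⁻ t, ENNReal.ofReal (logGammaPDF α (u / 2 + t)) *
        ENNReal.ofReal (logGammaPDF β (u / 2 - t)) := by
  have hΓα := Real.Gamma_pos_of_pos hα
  have hΓβ := Real.Gamma_pos_of_pos hβ
  rw [← ENNReal.ofReal_mul (by positivity), gammaGammaPDF_exp hα hβ hγ,
    ENNReal.ofReal_mul (by positivity), ofReal_besselK (by positivity),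
    ← lintegral_const_mul _ (by fun_prop)]
  refine lintegral_congr fun t => ?_
  rw [← ENNReal.ofReal_mul (by positivity), ← ENNReal.ofReal_mul (logGammaPDF_nonneg hα _),
    logGammaPDF, logGammaPDF, div_mul_div_comm, div_mul_eq_mul_div, ← Real.exp_add, ← Real.exp_add,
    Real.cosh_eq]
  congr 3
  have h1 : Real.exp (u / 2 + t) = Real.exp (u / 2) * Real.exp t := Real.exp_add _ _
  have h2 : Real.exp (u / 2 - t) = Real.exp (u / 2) * Real.exp (-t) := by
    rw [sub_eq_add_neg, Real.exp_add]
  rw [h1, h2]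
  ring

/-- A Gamma-Gamma SNR is the squared product of two independent Gamma variables, scaled. -/
lemma gammaGammaSNR_eq_map {α β γbar₂ : ℝ} (hα : 0 < α) (hβ : 0 < β) (hγ : 0 < γbar₂) :
    gammaGammaSNR α β γbar₂ = ((gammaMeasure α 1).prod (gammaMeasure β 1)).map
      (fun p => γbar₂ / (α * β) ^ 2 * (p.1 * p.2) ^ 2) := by
  have hαβ : 0 < α * β := mul_pos hα hβ
  have hc : 0 < γbar₂ / (α * β) ^ 2 := by positivity
  ext s hs
  have hφ : Measurable (s.indicator (1 : ℝ → ENNReal)) := measurable_one.indicator hs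
  have hφ₂ : Measurable fun p : ℝ × ℝ =>
      s.indicator (1 : ℝ → ENNReal) (γbar₂ / (α * β) ^ 2 * (p.1 * p.2) ^ 2) :=
    hφ.comp (by fun_prop)
  have hmα := (measurable_logGammaPDF α).ennreal_ofReal
  have hmβ := (measurable_logGammaPDF β).ennreal_ofReal
  have hl : gammaGammaSNR α β γbar₂ s =
      ∫⁻ u, (∫⁻ t, ENNReal.ofReal (logGammaPDF α (u / 2 + t)) *
        ENNReal.ofReal (logGammaPDF β (u / 2 - t))) *
        s.indicator 1 (γbar₂ / (α * β) ^ 2 * Real.exp (2 * u)) := by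
    rw [gammaGammaSNR, withDensity_apply _ hs, ← lintegral_indicator hs,
      lintegral_Ioi_eq_lintegral_exp hc two_pos]
    refine lintegral_congr fun u => ?_
    rw [← ofReal_gammaGammaPDF_exp hα hβ hγ]
    by_cases h : γbar₂ / (α * β) ^ 2 * Real.exp (2 * u) ∈ s
    · rw [Set.indicator_of_mem h, Set.indicator_of_mem h, Pi.one_apply, mul_one]
    · rw [Set.indicator_of_notMem h, Set.indicator_of_notMem h, mul_zero, mul_zero]
  rw [hl, ← lintegral_indicator_one hs, lintegral_map hφ (by fun_prop), lintegral_prod _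
    hφ₂.aemeasurable, lintegral_gammaMeasure_one hφ₂.lintegral_prod_right']
  have hinner : ∀ a : ℝ, ENNReal.ofReal (logGammaPDF α a) *
      ∫⁻ q, s.indicator 1 (γbar₂ / (α * β) ^ 2 * (Real.exp a * q) ^ 2) ∂gammaMeasure β 1 =
      ∫⁻ b, ENNReal.ofReal (logGammaPDF α a) * (ENNReal.ofReal (logGammaPDF β b) *
        s.indicator 1 (γbar₂ / (α * β) ^ 2 * Real.exp (2 * (a + b)))) := by
    intro a
    have h1 : Measurable fun q : ℝ =>
        s.indicator (1 : ℝ → ENNReal) (γbar₂ / (α * β) ^ 2 * (Real.exp a * q) ^ 2) :=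
      hφ.comp (by fun_prop)
    have h2 : Measurable fun b : ℝ =>
        s.indicator (1 : ℝ → ENNReal) (γbar₂ / (α * β) ^ 2 * (Real.exp a * Real.exp b) ^ 2) :=
      hφ.comp (by fun_prop)
    rw [lintegral_gammaMeasure_one h1, ← lintegral_const_mul _ (hmβ.fun_mul h2)]
    refine lintegral_congr fun b => ?_
    rw [← Real.exp_add, ← Real.exp_nat_mul]
    rfl
  simp_rw [hinner]
  set Ψ : ℝ → ℝ → ENNReal := fun a b => ENNReal.ofReal (logGammaPDF α a) *
    (ENNReal.ofReal (logGammaPDF β b) *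
        s.indicator 1 (γbar₂ / (α * β) ^ 2 * Real.exp (2 * (a + b)))) with hΨ
  have hΨm : Measurable (Function.uncurry Ψ) :=
    (hmα.comp measurable_fst).mul ((hmβ.comp measurable_snd).mul (hφ.comp (by fun_prop)))
  -- Substitute b = u/2 - t, then a = u - b; Tonelli provides the exchanges of order.
  calc _ = ∫⁻ u, ∫⁻ t, Ψ (u / 2 + t) (u / 2 - t) := by
        refine lintegral_congr fun u => ?_
        have h1 : Measurable fun t : ℝ => ENNReal.ofReal (logGammaPDF α (u / 2 + t)) :=
          hmα.comp (by fun_prop)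
        have h2 : Measurable fun t : ℝ => ENNReal.ofReal (logGammaPDF β (u / 2 - t)) :=
          hmβ.comp (by fun_prop)
        rw [← lintegral_mul_const _ (h1.fun_mul h2)]
        refine lintegral_congr fun t => ?_
        rw [hΨ, mul_assoc]
        ring_nf
    _ = ∫⁻ u, ∫⁻ b, Ψ (u - b) b := by
        refine lintegral_congr fun u => ?_
        rw [← lintegral_sub_left_eq_self (fun b => Ψ (u - b) b) (u / 2)]
        refine lintegral_congr fun t => ?_
        ring_nf
    _ = ∫⁻ b, ∫⁻ u, Ψ (u - b) b := lintegral_lintegral_swap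
        (hΨm.comp ((measurable_fst.sub measurable_snd).prodMk measurable_snd)).aemeasurable
    _ = ∫⁻ b, ∫⁻ a, Ψ a b := by
        refine lintegral_congr fun b => ?_
        exact lintegral_sub_right_eq_self (fun a => Ψ a b) b
    _ = ∫⁻ a, ∫⁻ b, Ψ a b := lintegral_lintegral_swap (hΨm.comp measurable_swap).aemeasurable

/-! ### Mellin transform of an averaged exponential -/

lemma integrableOn_cpow_mul_exp_neg_mul {s : ℂ} {r : ℝ} (hs : 0 < s.re) (hr : 0 < r) :
    IntegrableOn (fun t : ℝ => (t : ℂ) ^ (s - 1) * Complex.exp (-(r * t))) (Set.Ioi 0) := by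
  have h : IntegrableOn (fun t : ℝ => t ^ (s.re - 1) * Real.exp (-(r * t))) (Set.Ioi 0) := by
    refine .of_integral_ne_zero ?_
    rw [Real.integral_rpow_mul_exp_neg_mul_Ioi hs hr]
    have := Real.Gamma_pos_of_pos hs
    positivity
  refine h.mono' ?_ ?_
  · refine ContinuousOn.aestronglyMeasurable (fun t ht => ?_) measurableSet_Ioi
    refine ContinuousAt.continuousWithinAt (.mul ?_ (by fun_prop))
    exact (continuousAt_cpow_const (Or.inl (by simpa using ht))).comp
      Complex.continuous_ofReal.continuousAt
  · refine (ae_restrict_iff' measurableSet_Ioi).2 (.of_forall fun t ht => ?_)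
    rw [norm_mul, Complex.norm_cpow_eq_rpow_re_of_pos ht, Complex.norm_exp]
    simp

lemma integral_norm_cpow_mul_exp_neg_mul {s : ℂ} {r : ℝ} (hs : 0 < s.re) (hr : 0 < r) :
    ∫ t in Set.Ioi (0 : ℝ), ‖(t : ℂ) ^ (s - 1) * Complex.exp (-(r * t))‖ =
      (1 / r) ^ s.re * Real.Gamma s.re := by
  rw [← Real.integral_rpow_mul_exp_neg_mul_Ioi hs hr]
  refine setIntegral_congr_fun measurableSet_Ioi fun t ht => ?_
  rw [norm_mul, Complex.norm_cpow_eq_rpow_re_of_pos ht, Complex.norm_exp]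
  simp

/-- For fixed y > 0 the transform of exp(-a/y) in a is Γ(s) y^s. Fubini applies because the absolute
integral in a is Γ(Re s) y^(Re s), integrable by the moment assumption. -/
lemma hasMellin_integral_exp_neg_div (ν : Measure ℝ) [SFinite ν] (hpos : ∀ᵐ y ∂ν, 0 < y) {s : ℂ}
    (hs : 0 < s.re) (hint : Integrable (fun y => y ^ s.re) ν) :
    HasMellin (fun a : ℝ => ∫ y, Complex.exp (-(a / y : ℝ)) ∂ν) s
      (Complex.Gamma s * ∫ y : ℝ, (y : ℂ) ^ s ∂ν) := by
  set F : ℝ × ℝ → ℂ := fun q =>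
    (q.1 : ℂ) ^ (s - 1) * Complex.exp (-(((1 / q.2 : ℝ) : ℂ) * (q.1 : ℂ))) with hF
  have hFm : Measurable F := by
    refine Measurable.mul ?_ (by fun_prop)
    exact (Complex.measurable_ofReal.comp measurable_fst).pow_const _
  have hFint : Integrable F ((volume.restrict (Set.Ioi 0)).prod ν) := by
    rw [integrable_prod_iff' hFm.aestronglyMeasurable]
    have hnorm : ∀ᵐ y ∂ν, y ^ s.re * Real.Gamma s.re = ∫ a in Set.Ioi 0, ‖F (a, y)‖ := by
      filter_upwards [hpos] with y hy
      have h := integral_norm_cpow_mul_exp_neg_mul (r := 1 / y) hs (one_div_pos.2 hy)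
      rw [one_div_one_div] at h
      exact h.symm
    refine ⟨?_, (hint.mul_const (Real.Gamma s.re)).congr hnorm⟩
    filter_upwards [hpos] with y hy
    exact integrableOn_cpow_mul_exp_neg_mul (r := 1 / y) hs (one_div_pos.2 hy)
  have hFeq : ∀ a : ℝ, ∫ y, F (a, y) ∂ν =
      (a : ℂ) ^ (s - 1) • ∫ y, Complex.exp (-(a / y : ℝ)) ∂ν := by
    intro a
    rw [hF, smul_eq_mul, ← integral_const_mul]
    refine integral_congr_ae (.of_forall fun y => ?_)
    simp only
    rw [← Complex.ofReal_mul, one_div_mul_eq_div]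
  constructor
  · have := hFint.integral_prod_left
    simp_rw [hFeq] at this
    exact this
  · rw [mellin]
    simp_rw [← hFeq]
    rw [integral_integral_swap (f := fun a y => F (a, y)) hFint, ← integral_const_mul]
    refine integral_congr_ae ?_
    filter_upwards [hpos] with y hy
    have h := Complex.integral_cpow_mul_exp_neg_mul_Ioi (r := 1 / y) hs (one_div_pos.2 hy)
    rw [mul_comm, Complex.ofReal_div, Complex.ofReal_one, one_div_one_div] at h
    exact (congrArg _ (by ext t; simp [hF])).trans h

/-- Continuity is what pointwise Mellin inversion requires; dominated convergence gives it with the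
bound 1. -/
lemma continuousAt_integral_exp_neg_div (ν : Measure ℝ) [IsFiniteMeasure ν]
    (hpos : ∀ᵐ y ∂ν, 0 < y) {a : ℝ} (ha : 0 < a) :
    ContinuousAt (fun a : ℝ => ∫ y, Complex.exp (-(a / y : ℝ)) ∂ν) a := by
  refine continuousAt_of_dominated (bound := fun _ => 1) (.of_forall fun x => ?_) ?_
    (integrable_const 1) (.of_forall fun y => ?_)
  · exact Measurable.aestronglyMeasurable (by fun_prop)
  · filter_upwards [eventually_gt_nhds ha] with x hx
    filter_upwards [hpos] with y hy
    rw [← Complex.ofReal_neg, ← Complex.ofReal_exp, Complex.norm_real, Real.norm_eq_abs,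
      Real.abs_exp, Real.exp_le_one_iff, neg_nonpos]
    positivity
  · fun_prop

/-! ### Gamma function on vertical lines -/

lemma norm_complex_Gamma_le {s : ℂ} (hs : 0 < s.re) :
    ‖Complex.Gamma s‖ ≤ Real.Gamma s.re := by
  rw [Complex.Gamma_eq_integral hs, Real.Gamma_eq_integral hs, Complex.GammaIntegral]
  refine (norm_integral_le_integral_norm _).trans (le_of_eq ?_)
  refine setIntegral_congr_fun measurableSet_Ioi fun t ht => ?_
  rw [norm_mul, Complex.norm_cpow_eq_rpow_re_of_pos ht, Complex.norm_real, Real.norm_eq_abs,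
    Real.abs_exp]
  simp

/-- Two uses of the functional equation give quadratic decay on vertical lines, enough for
integrability without Stirling's formula. -/
lemma norm_complex_Gamma_le_div {s : ℂ} (hs : 0 < s.re) :
    ‖Complex.Gamma s‖ ≤ Real.Gamma (s.re + 2) / ‖s‖ ^ 2 := by
  have hs0 : s ≠ 0 := fun h => by simp [h] at hs
  have hs1 : s + 1 ≠ 0 := fun h => by
    have := congrArg Complex.re h
    simp at this
    linarith
  have h2 : Complex.Gamma (s + 2) = (s + 1) * (s * Complex.Gamma s) := by
    rw [← Complex.Gamma_add_one s hs0, ← Complex.Gamma_add_one _ hs1]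
    ring_nf
  have hle : ‖s‖ ≤ ‖s + 1‖ := by
    rw [← sq_le_sq₀ (norm_nonneg _) (norm_nonneg _), Complex.sq_norm, Complex.sq_norm,
      Complex.normSq_apply, Complex.normSq_apply]
    simp
    nlinarith
  have hpos : 0 < ‖s‖ := norm_pos_iff.2 hs0
  rw [le_div_iff₀ (by positivity)]
  calc ‖Complex.Gamma s‖ * ‖s‖ ^ 2 = ‖s‖ * (‖s‖ * ‖Complex.Gamma s‖) := by ring
    _ ≤ ‖s + 1‖ * (‖s‖ * ‖Complex.Gamma s‖) := by gcongr
    _ = ‖Complex.Gamma (s + 2)‖ := by rw [h2, norm_mul, norm_mul]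
    _ ≤ Real.Gamma (s.re + 2) := by
      have := norm_complex_Gamma_le (s := s + 2) (by simp; linarith)
      simpa using this

lemma continuous_Gamma_vertical {σ : ℝ} (hσ : 0 < σ) (k : ℝ) :
    Continuous fun t : ℝ => Complex.Gamma (σ + k * t * Complex.I) := by
  refine continuous_iff_continuousAt.2 fun t => ?_
  refine ContinuousAt.comp (g := Complex.Gamma) ?_ (by fun_prop)
  refine (Complex.differentiableAt_Gamma _ fun m h => ?_).continuousAt
  have := congrArg Complex.re h
  simp at this
  have hm : (0 : ℝ) ≤ m := Nat.cast_nonneg m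
  linarith

/-- `Γ` times a bounded continuous function is integrable along vertical lines on the right. -/
lemma verticalIntegrable_Gamma_mul {σ : ℝ} (hσ : 0 < σ) {f : ℂ → ℂ}
    (hf : Continuous fun t : ℝ => f (σ + t * Complex.I)) {C : ℝ}
    (hC : ∀ t : ℝ, ‖f (σ + t * Complex.I)‖ ≤ C) :
    Complex.VerticalIntegrable (fun s => Complex.Gamma s * f s) σ := by
  have hm : 0 < min (σ ^ 2) 1 := lt_min (by positivity) one_pos
  have hΓ := continuous_Gamma_vertical hσ 1
  simp only [Complex.ofReal_one, one_mul] at hΓ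
  refine (integrable_inv_one_add_sq.const_mul (Real.Gamma (σ + 2) / min (σ ^ 2) 1 * C)).mono'
    (hΓ.mul hf).aestronglyMeasurable (.of_forall fun t => ?_)
  have hre : (σ + t * Complex.I : ℂ).re = σ := by simp
  have h1 := norm_complex_Gamma_le_div (s := σ + t * Complex.I) (by rwa [hre])
  have hnorm : ‖(σ + t * Complex.I : ℂ)‖ ^ 2 = σ ^ 2 + t ^ 2 := by
    rw [Complex.sq_norm, Complex.normSq_apply]
    simp
    ring
  have hΓpos : 0 < Real.Gamma (σ + 2) := Real.Gamma_pos_of_pos (by linarith)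
  rw [hre, hnorm] at h1
  have h2 : min (σ ^ 2) 1 * (1 + t ^ 2) ≤ σ ^ 2 + t ^ 2 := by
    have h3 := min_le_left (σ ^ 2) 1
    have h4 := mul_le_mul_of_nonneg_right (min_le_right (σ ^ 2) 1) (sq_nonneg t)
    linarith
  calc ‖Complex.Gamma (σ + t * Complex.I) * f (σ + t * Complex.I)‖
      ≤ Real.Gamma (σ + 2) / (σ ^ 2 + t ^ 2) * C := by
        rw [norm_mul]
        exact mul_le_mul h1 (hC t) (norm_nonneg _) (by positivity)
    _ ≤ Real.Gamma (σ + 2) / (min (σ ^ 2) 1 * (1 + t ^ 2)) * C := by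
        have := (norm_nonneg _).trans (hC t)
        gcongr
    _ = Real.Gamma (σ + 2) / min (σ ^ 2) 1 * C * (1 + t ^ 2)⁻¹ := by
        field_simp

/-! ### Moments of Gamma and Gamma-Gamma laws -/

lemma ae_pos_gammaMeasure_one (a : ℝ) : ∀ᵐ x ∂gammaMeasure a 1, 0 < x := by
  rw [gammaMeasure_one_eq_withDensity]
  exact (withDensity_absolutelyContinuous _ _).ae_le (ae_restrict_mem measurableSet_Ioi)

lemma integrable_rpow_gammaMeasure_one {a r : ℝ} (ha : 0 < a) (har : 0 < a + r) :
    Integrable (fun x => x ^ r) (gammaMeasure a 1) := by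
  have hΓ := Real.Gamma_pos_of_pos ha
  rw [gammaMeasure_one_eq_withDensity, integrable_withDensity_iff (by fun_prop) (by simp)]
  have h : IntegrableOn (fun t : ℝ => t ^ (a + r - 1) * Real.exp (-(1 * t))) (Set.Ioi 0) := by
    refine .of_integral_ne_zero ?_
    rw [Real.integral_rpow_mul_exp_neg_mul_Ioi har one_pos]
    have := Real.Gamma_pos_of_pos har
    positivity
  refine (h.const_mul (Real.Gamma a)⁻¹).congr ?_
  filter_upwards [ae_restrict_mem measurableSet_Ioi] with x hx
  have hx : 0 < x := hx
  rw [ENNReal.toReal_ofReal (by positivity), one_mul,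
    show a + r - 1 = r + (a - 1) by ring, Real.rpow_add hx]
  ring

lemma integral_cpow_gammaMeasure_one {a : ℝ} (ha : 0 < a) {z : ℂ} (haz : 0 < a + z.re) :
    ∫ x : ℝ, (x : ℂ) ^ z ∂gammaMeasure a 1 = Complex.Gamma (a + z) / Real.Gamma a := by
  have hΓ := Real.Gamma_pos_of_pos ha
  have h := Complex.integral_cpow_mul_exp_neg_mul_Ioi (a := a + z) (r := 1) (by simpa) one_pos
  rw [Complex.ofReal_one, div_one, Complex.one_cpow, one_mul] at h
  rw [gammaMeasure_one_eq_withDensity, integral_withDensity_eq_integral_toReal_smul (by fun_prop)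
    (by simp), div_eq_inv_mul, ← h, ← integral_const_mul]
  refine setIntegral_congr_fun measurableSet_Ioi fun x hx => ?_
  have hx : 0 < x := hx
  rw [ENNReal.toReal_ofReal (by positivity), Complex.real_smul,
    show (a : ℂ) + z - 1 = ((a - 1 : ℝ) : ℂ) + z by push_cast; ring,
    Complex.cpow_add _ _ (by exact_mod_cast hx.ne')]
  push_cast [Complex.ofReal_cpow hx.le]
  ring_nf

lemma isProbabilityMeasure_gammaGammaSNR {α β γbar₂ : ℝ} (hα : 0 < α) (hβ : 0 < β)
    (hγ : 0 < γbar₂) : IsProbabilityMeasure (gammaGammaSNR α β γbar₂) := by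
  rw [gammaGammaSNR_eq_map hα hβ hγ]
  have := isProbabilityMeasure_gammaMeasure hα one_pos
  have := isProbabilityMeasure_gammaMeasure hβ one_pos
  exact Measure.isProbabilityMeasure_map (by fun_prop)

lemma ae_pos_gammaGammaSNR (α β γbar₂ : ℝ) : ∀ᵐ y ∂gammaGammaSNR α β γbar₂, 0 < y :=
  (withDensity_absolutelyContinuous _ _).ae_le (ae_restrict_mem measurableSet_Ioi)

lemma ae_pos_prod_gammaMeasure_one (α β : ℝ) :
    ∀ᵐ p ∂(gammaMeasure α 1).prod (gammaMeasure β 1), 0 < p.1 ∧ 0 < p.2 :=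
  (Measure.quasiMeasurePreserving_fst.ae (ae_pos_gammaMeasure_one α)).and
    (Measure.quasiMeasurePreserving_snd.ae (ae_pos_gammaMeasure_one β))

lemma integrable_rpow_gammaGammaSNR {α β γbar₂ r : ℝ} (hα : 0 < α) (hβ : 0 < β) (hγ : 0 < γbar₂)
    (hr : 0 ≤ r) : Integrable (fun y => y ^ r) (gammaGammaSNR α β γbar₂) := by
  rw [gammaGammaSNR_eq_map hα hβ hγ, integrable_map_measure
    (Measurable.aestronglyMeasurable (by fun_prop)) (by fun_prop)]
  have h := (integrable_rpow_gammaMeasure_one (r := 2 * r) hα (by linarith)).mul_prod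
    (integrable_rpow_gammaMeasure_one (r := 2 * r) hβ (by linarith))
  refine (h.const_mul ((γbar₂ / (α * β) ^ 2) ^ r)).congr ?_
  filter_upwards [ae_pos_prod_gammaMeasure_one α β] with p hp
  have hαβ : 0 < α * β := mul_pos hα hβ
  have h1 := hp.1
  have h2 := hp.2
  have hsq : ((p.1 * p.2) ^ 2) ^ r = (p.1 * p.2) ^ (2 * r) := by
    rw [← Real.rpow_natCast, ← Real.rpow_mul (by positivity), Nat.cast_ofNat]
  rw [Function.comp_apply, Real.mul_rpow (by positivity) (by positivity), hsq,
    Real.mul_rpow h1.le h2.le]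

/-- The product representation splits y^s into a constant and the powers 2s of two independent Gamma
variables, so no Mellin integral of a Bessel function is needed. -/
lemma integral_cpow_gammaGammaSNR {α β γbar₂ : ℝ} (hα : 0 < α) (hβ : 0 < β) (hγ : 0 < γbar₂)
    {s : ℂ} (hs : 0 ≤ s.re) :
    ∫ y : ℝ, (y : ℂ) ^ s ∂gammaGammaSNR α β γbar₂ =
      ((γbar₂ / (α * β) ^ 2 : ℝ) : ℂ) ^ s * (Complex.Gamma (α + 2 * s) * Complex.Gamma (β + 2 * s) /
        (Real.Gamma α * Real.Gamma β)) := by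
  have hαβ : 0 < α * β := mul_pos hα hβ
  rw [gammaGammaSNR_eq_map hα hβ hγ, integral_map (by fun_prop)
    ((Complex.measurable_ofReal.pow_const s).aestronglyMeasurable)]
  have key : ∀ᵐ p ∂(gammaMeasure α 1).prod (gammaMeasure β 1),
      ((γbar₂ / (α * β) ^ 2 * (p.1 * p.2) ^ 2 : ℝ) : ℂ) ^ s =
      ((γbar₂ / (α * β) ^ 2 : ℝ) : ℂ) ^ s * ((p.1 : ℂ) ^ (2 * s) * (p.2 : ℂ) ^ (2 * s)) := by
    filter_upwards [ae_pos_prod_gammaMeasure_one α β] with p hp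
    have h1 := hp.1
    have h2 := hp.2
    have h12 : 0 < p.1 * p.2 := mul_pos h1 h2
    rw [Complex.ofReal_mul, Complex.mul_cpow_ofReal_nonneg (by positivity) (by positivity),
      sq (p.1 * p.2),
      Complex.ofReal_mul (p.1 * p.2), Complex.mul_cpow_ofReal_nonneg h12.le h12.le,
      Complex.ofReal_mul, Complex.mul_cpow_ofReal_nonneg h1.le h2.le, two_mul,
      Complex.cpow_add _ _ (by exact_mod_cast h1.ne'),
      Complex.cpow_add _ _ (by exact_mod_cast h2.ne')]
    ring
  rw [integral_congr_ae key, integral_const_mul, integral_prod_mul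
    (fun x : ℝ => (x : ℂ) ^ (2 * s)) (fun x : ℝ => (x : ℂ) ^ (2 * s)),
    integral_cpow_gammaMeasure_one hα (by simp; linarith),
    integral_cpow_gammaMeasure_one hβ (by simp; linarith), div_mul_div_comm]

/-- Mellin-Barnes representation of `E[exp(-a / y)]` for a Gamma-Gamma variable `y`. -/
lemma integral_exp_neg_div_gammaGammaSNR {α β γbar₂ a σ : ℝ} (hα : 0 < α) (hβ : 0 < β)
    (hγ : 0 < γbar₂) (ha : 0 < a) (hσ : 0 < σ) :
    ∫ y, Complex.exp (-(a / y : ℝ)) ∂gammaGammaSNR α β γbar₂ =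
      1 / (2 * (Real.pi : ℂ)) * ∫ t : ℝ, (a : ℂ) ^ (-(σ + t * Complex.I)) *
        (Complex.Gamma (σ + t * Complex.I) *
          (((γbar₂ / (α * β) ^ 2 : ℝ) : ℂ) ^ (σ + t * Complex.I) *
            (Complex.Gamma (α + 2 * (σ + t * Complex.I)) *
              Complex.Gamma (β + 2 * (σ + t * Complex.I)) /
                (Real.Gamma α * Real.Gamma β)))) := by
  have hprob := isProbabilityMeasure_gammaGammaSNR hα hβ hγ
  set ν := gammaGammaSNR α β γbar₂ with hν
  have hpos : ∀ᵐ y ∂ν, 0 < y := ae_pos_gammaGammaSNR α β γbar₂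
  set g : ℝ → ℂ := fun a => ∫ y, Complex.exp (-(a / y : ℝ)) ∂ν with hg
  have hαβ : 0 < α * β := mul_pos hα hβ
  have hc : ((γbar₂ / (α * β) ^ 2 : ℝ) : ℂ) ≠ 0 := by
    have : 0 < γbar₂ / (α * β) ^ 2 := by positivity
    exact_mod_cast this.ne'
  have hmellin : ∀ s : ℂ, 0 < s.re →
      HasMellin g s (Complex.Gamma s * ∫ y : ℝ, (y : ℂ) ^ s ∂ν) := fun s hs =>
    hasMellin_integral_exp_neg_div ν hpos hs (integrable_rpow_gammaGammaSNR hα hβ hγ hs.le)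
  have hre : ∀ t : ℝ, (σ + t * Complex.I : ℂ).re = σ := fun t => by simp
  have hline : ∀ t : ℝ, mellin g (σ + t * Complex.I) = Complex.Gamma (σ + t * Complex.I) *
      ∫ y : ℝ, (y : ℂ) ^ (σ + t * Complex.I : ℂ) ∂ν := fun t =>
    (hmellin _ (by rwa [hre])).2
  have hcont : Continuous fun t : ℝ => ∫ y : ℝ, (y : ℂ) ^ (σ + t * Complex.I : ℂ) ∂ν := by
    have h : ∀ t : ℝ, ∫ y : ℝ, (y : ℂ) ^ (σ + t * Complex.I : ℂ) ∂ν =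
        ((γbar₂ / (α * β) ^ 2 : ℝ) : ℂ) ^ (σ + t * Complex.I : ℂ) *
        (Complex.Gamma ((α + 2 * σ : ℝ) + (2 : ℝ) * t * Complex.I) *
          Complex.Gamma ((β + 2 * σ : ℝ) + (2 : ℝ) * t * Complex.I) /
            (Real.Gamma α * Real.Gamma β)) := by
      intro t
      rw [integral_cpow_gammaGammaSNR hα hβ hγ (by rw [hre]; exact hσ.le)]
      push_cast
      ring_nf
    simp_rw [h]
    refine .mul (.const_cpow (by fun_prop) (.inl hc)) (.div_const (.mul ?_ ?_) _)
    · exact continuous_Gamma_vertical (by positivity) 2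
    · exact continuous_Gamma_vertical (by positivity) 2
  -- Boundedness of the moment factor suffices, since the factor Γ(s) alone supplies the decay.
  have hbound : ∀ t : ℝ, ‖∫ y : ℝ, (y : ℂ) ^ (σ + t * Complex.I : ℂ) ∂ν‖ ≤ ∫ y, y ^ σ ∂ν := by
    intro t
    refine norm_integral_le_of_norm_le (integrable_rpow_gammaGammaSNR hα hβ hγ hσ.le) ?_
    filter_upwards [hpos] with y hy
    rw [Complex.norm_cpow_eq_rpow_re_of_pos hy, hre]
  have hvert : Complex.VerticalIntegrable (mellin g) σ := by
    have := verticalIntegrable_Gamma_mul hσ (f := fun s => ∫ y : ℝ, (y : ℂ) ^ s ∂ν) hcont hbound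
    rw [Complex.VerticalIntegrable] at this ⊢
    simpa only [hline] using this
  have hinv := mellinInv_mellin_eq σ g ha (hmellin σ (by simpa)).1 hvert
    (continuousAt_integral_exp_neg_div ν hpos ha)
  change g a = _
  rw [← hinv, mellinInv, Complex.real_smul]
  push_cast
  congr 1
  refine integral_congr_ae (.of_forall fun t => ?_)
  simp only
  rw [hline, integral_cpow_gammaGammaSNR hα hβ hγ (by rw [hre]; exact hσ.le), smul_eq_mul]
  push_cast
  rfl

/-- Legendre duplication fuses each pair of half-shifted Gamma factors; the two factors 2^(-2s) give
16^(-s), the two √π give π, and the parameter 0 gives Γ(s). The sign of s is reversed to match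
Mellin inversion. -/
lemma meijerKernel_neg_eq (α β : ℝ) (s : ℂ) :
    meijerKernel 5 0 (![] : Fin 0 → ℂ)
      ![(α : ℂ) / 2, ((α : ℂ) + 1) / 2, (β : ℂ) / 2, ((β : ℂ) + 1) / 2, 0] (-s) =
    (2 : ℂ) ^ (2 - (α : ℂ) - β) * Real.pi * (16 : ℂ) ^ (-s) * Complex.Gamma s *
      (Complex.Gamma (α + 2 * s) * Complex.Gamma (β + 2 * s)) := by
  have hdup : ∀ x : ℝ, Complex.Gamma ((x : ℂ) / 2 + s) * Complex.Gamma (((x : ℂ) + 1) / 2 + s) =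
      Complex.Gamma (x + 2 * s) * (2 : ℂ) ^ (1 - ((x : ℂ) + 2 * s)) * (√Real.pi : ℝ) := by
    intro x
    have h := Complex.Gamma_mul_Gamma_add_half ((x : ℂ) / 2 + s)
    rw [show (x : ℂ) / 2 + s + 1 / 2 = ((x : ℂ) + 1) / 2 + s by ring,
      show 2 * ((x : ℂ) / 2 + s) = x + 2 * s by ring] at h
    exact h
  have h16 : (16 : ℂ) ^ (-s) = (2 : ℂ) ^ (-4 * s) := by
    rw [Complex.cpow_def_of_ne_zero (by norm_num), Complex.cpow_def_of_ne_zero (by norm_num)]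
    have h : Complex.log 16 = 4 * Complex.log 2 := by
      have hr : Real.log 16 = 4 * Real.log 2 := by
        rw [show (16 : ℝ) = 2 ^ 4 by norm_num, Real.log_pow]
        norm_num
      have h' : Complex.log ((16 : ℝ) : ℂ) = 4 * Complex.log ((2 : ℝ) : ℂ) := by
        rw [← Complex.ofReal_log (by norm_num), ← Complex.ofReal_log (by norm_num), hr]
        push_cast
        rfl
      simpa using h'
    rw [h]
    ring_nf
  have hpow : (2 : ℂ) ^ (1 - ((α : ℂ) + 2 * s)) * (2 : ℂ) ^ (1 - ((β : ℂ) + 2 * s)) =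
      (2 : ℂ) ^ (2 - (α : ℂ) - β) * (16 : ℂ) ^ (-s) := by
    rw [h16, ← Complex.cpow_add _ _ two_ne_zero, ← Complex.cpow_add _ _ two_ne_zero]
    ring_nf
  have hpi : ((√Real.pi : ℝ) : ℂ) * (√Real.pi : ℝ) = Real.pi := by
    rw [← Complex.ofReal_mul, Real.mul_self_sqrt Real.pi_pos.le]
  rw [meijerKernel, Fin.prod_univ_five, Fin.prod_univ_zero, mul_one]
  simp only [Fin.isValue, Matrix.cons_val, sub_neg_eq_add, zero_add]
  norm_num
  linear_combination (Complex.Gamma ((β : ℂ) / 2 + s) * Complex.Gamma (((β : ℂ) + 1) / 2 + s) *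
    Complex.Gamma s) * hdup α + (Complex.Gamma (α + 2 * s) * (2 : ℂ) ^ (1 - ((α : ℂ) + 2 * s)) *
    (√Real.pi : ℝ) * Complex.Gamma s) * hdup β + (Complex.Gamma (α + 2 * s) * Complex.Gamma (β + 2 * s) * Complex.Gamma s *
    (((√Real.pi : ℝ) : ℂ) * (√Real.pi : ℝ))) * hpow + (Complex.Gamma (α + 2 * s) *
      Complex.Gamma (β + 2 * s) * Complex.Gamma s * ((2 : ℂ) ^ (2 - (α : ℂ) - β) *
        (16 : ℂ) ^ (-s))) * hpi

/-- Laplace-type transform of a Gamma-Gamma law as a Meijer function. -/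
lemma integral_exp_neg_div_eq_meijerG {α β γbar₂ a : ℝ} (hα : 0 < α) (hβ : 0 < β)
    (hγ : 0 < γbar₂) (ha : 0 < a) :
    ((∫ y, Real.exp (-(a / y)) ∂gammaGammaSNR α β γbar₂ : ℝ) : ℂ) =
      ((2 ^ (α + β - 2) / (Real.pi * Real.Gamma α * Real.Gamma β) : ℝ) : ℂ) *
        meijerG 5 0 (![] : Fin 0 → ℂ)
          ![(α : ℂ) / 2, ((α : ℂ) + 1) / 2, (β : ℂ) / 2, ((β : ℂ) + 1) / 2, 0]
          (((α * β) ^ 2 * a / (16 * γbar₂) : ℝ) : ℂ) := by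
  have hαβ : 0 < α * β := mul_pos hα hβ
  have hex : ∃ c : ℝ, SeparatesPoles 5 0 (![] : Fin 0 → ℂ)
      ![(α : ℂ) / 2, ((α : ℂ) + 1) / 2, (β : ℂ) / 2, ((β : ℂ) + 1) / 2, 0] c := by
    refine ⟨-1, fun j _ => ?_, fun j => j.elim0⟩
    fin_cases j <;> simp <;> linarith
  rw [meijerG, dif_pos hex]
  -- Whatever line the definition chooses, the parameter 0 puts it left of the origin, so its
  -- reflection is an admissible abscissa for Mellin inversion.
  have hneg : hex.choose < 0 := by
    simpa using hex.choose_spec.1 4 (by norm_num)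
  obtain ⟨σ, hσ⟩ : ∃ σ, σ = -hex.choose := ⟨_, rfl⟩
  have hch : hex.choose = -σ := by rw [hσ, neg_neg]
  rw [hch]
  have hσ0 : 0 < σ := by linarith
  have hcast : ((∫ y, Real.exp (-(a / y)) ∂gammaGammaSNR α β γbar₂ : ℝ) : ℂ) =
      ∫ y, Complex.exp (-(a / y : ℝ)) ∂gammaGammaSNR α β γbar₂ := by
    rw [← integral_complex_ofReal]
    push_cast
    rfl
  rw [hcast, integral_exp_neg_div_gammaGammaSNR hα hβ hγ ha hσ0, mul_left_comm]
  congr 1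
  -- The contour variable is minus the Mellin variable, hence the reflection t ↦ -t.
  rw [← integral_const_mul, ← integral_neg_eq_self]
  refine integral_congr_ae (.of_forall fun t => ?_)
  simp only
  set s : ℂ := σ + ((-t : ℝ) : ℂ) * Complex.I with hs
  have hs' : ((-σ : ℝ) : ℂ) + t * Complex.I = -s := by
    rw [hs]
    push_cast
    ring
  set z : ℝ := (α * β) ^ 2 * a / (16 * γbar₂) with hz
  have hz0 : 0 < z := by positivity
  have ha' : a = z * (16 * (γbar₂ / (α * β) ^ 2)) := by
    rw [hz]
    field_simp
  have hc0 : 0 < γbar₂ / (α * β) ^ 2 := by positivity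
  have hapow : (a : ℂ) ^ (-s) = (z : ℂ) ^ (-s) * ((16 : ℂ) ^ (-s) *
      ((γbar₂ / (α * β) ^ 2 : ℝ) : ℂ) ^ (-s)) := by
    rw [ha', Complex.ofReal_mul, Complex.mul_cpow_ofReal_nonneg hz0.le (by positivity),
      Complex.ofReal_mul 16, Complex.mul_cpow_ofReal_nonneg (by norm_num) hc0.le]
    norm_num
  have hcpow : ((γbar₂ / (α * β) ^ 2 : ℝ) : ℂ) ^ (-s) *
      ((γbar₂ / (α * β) ^ 2 : ℝ) : ℂ) ^ s = 1 := by
    rw [← Complex.cpow_add _ _ (by exact_mod_cast hc0.ne'), neg_add_cancel, Complex.cpow_zero]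
  have hconst : ((2 ^ (α + β - 2) / (Real.pi * Real.Gamma α * Real.Gamma β) : ℝ) : ℂ) *
      ((2 : ℂ) ^ (2 - (α : ℂ) - β) * Real.pi) = 1 / (Real.Gamma α * Real.Gamma β) := by
    have h2 : (2 : ℂ) ^ (2 - (α : ℂ) - β) = ((2 ^ (2 - α - β) : ℝ) : ℂ) := by
      rw [Complex.ofReal_cpow two_pos.le]
      push_cast
      rfl
    have h3 : (2 : ℝ) ^ (α + β - 2) * 2 ^ (2 - α - β) = 1 := by
      rw [← Real.rpow_add two_pos]
      ring_nf
      exact Real.rpow_zero 2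
    have hΓα := (Real.Gamma_pos_of_pos hα).ne'
    have hΓβ := (Real.Gamma_pos_of_pos hβ).ne'
    have hπ := Real.pi_pos.ne'
    rw [h2]
    norm_cast
    field_simp
    linear_combination h3
  rw [hs', meijerKernel_neg_eq, hapow]
  linear_combination ((z : ℂ) ^ (-s) * (16 : ℂ) ^ (-s) * Complex.Gamma s *
    (Complex.Gamma (α + 2 * s) * Complex.Gamma (β + 2 * s) / (Real.Gamma α * Real.Gamma β))) *
      hcpow - ((z : ℂ) ^ (-s) * (16 : ℂ) ^ (-s) * Complex.Gamma s *
    (Complex.Gamma (α + 2 * s) * Complex.Gamma (β + 2 * s))) * hconst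

/-! ### End-to-end quality -/

lemma one_le_kappa (pa : Amplifier) (A σ meanPow P₁ σ₀ : ℝ) :
    1 ≤ kappa pa A σ meanPow P₁ σ₀ := by
  have h : 0 ≤ pa.distortionVar A σ := integral_nonneg fun z => sq_nonneg _
  have : 0 ≤ pa.distortionVar A σ /
      (pa.scale A σ ^ 2 * fixedGain σ meanPow P₁ σ₀ ^ 2 * σ₀ ^ 2) := div_nonneg h (by positivity)
  rw [kappa]
  linarith

lemma measurable_sndr (I κ M : ℝ) : Measurable fun q : ℝ × ℝ => sndr I κ M q.1 q.2 := by
  unfold sndr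
  fun_prop

lemma sndr_denom_pos {I κ M x u : ℝ} (hI : 0 ≤ I) (hκ : 0 < κ) (hM : 0 ≤ M) (hx : 0 ≤ x)
    (hu : 0 < u) : 0 < I * x * u + (1 + I) * κ * u + (1 + I) * (M + κ) := by
  positivity

/-- Clearing denominators leaves γ(1+I)(κu + M + κ) ≤ (1 - Iγ)xu, and Iγ < 1 keeps the direction on
division. The threshold is affine in 1/u. -/
lemma le_sndr_iff {I κ M x u γ : ℝ} (hI : 0 ≤ I) (hκ : 0 < κ) (hM : 0 ≤ M) (hx : 0 ≤ x)
    (hu : 0 < u) (hγ : I * γ < 1) :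
    γ ≤ sndr I κ M x u ↔ γ * (1 + I) * (κ + (M + κ) / u) / (1 - I * γ) ≤ x := by
  rw [sndr, le_div_iff₀ (sndr_denom_pos hI hκ hM hx hu), div_le_iff₀ (sub_pos.2 hγ),
    ← mul_le_mul_iff_left₀ hu (b := γ * (1 + I) * (κ + (M + κ) / u))]
  have h : γ * (1 + I) * (κ + (M + κ) / u) * u = γ * (1 + I) * (κ * u + (M + κ)) := by
    field_simp
  rw [h]
  constructor <;> intro h <;> linarith

/-- Image leakage grows with the signal and caps the ratio strictly below 1/I ≤ γ, however strong
the hops are. -/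
lemma sndr_lt {I κ M x u γ : ℝ} (hI : 0 ≤ I) (hκ : 0 < κ) (hM : 0 ≤ M) (hx : 0 ≤ x)
    (hu : 0 < u) (hγ0 : 0 < γ) (hγ : 1 ≤ I * γ) : sndr I κ M x u < γ := by
  rw [sndr, div_lt_iff₀ (sndr_denom_pos hI hκ hM hx hu)]
  have h1 : x * u ≤ I * γ * (x * u) := le_mul_of_one_le_left (by positivity) hγ
  have h2 : 0 < γ * ((1 + I) * κ * u + (1 + I) * (M + κ)) := by positivity
  linarith

lemma hopSNR_nonneg {P₁ σ₀ : ℝ} (hP₁ : 0 < P₁) (h : ℂ) : 0 ≤ hopSNR P₁ σ₀ h := by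
  unfold hopSNR
  positivity

/-- Entries of two independent families, selected by an index that depends on the first family
only, are distributed as if the index were fixed for the second family. -/
lemma prod_setOf_selected_mem {ι E F : Type*} [Fintype ι] [MeasurableSpace ι]
    [MeasurableSingletonClass ι] [MeasurableSpace E] [MeasurableSpace F]
    (π : Measure (ι → E)) [SFinite π] (τ : Measure (ι → F)) [SFinite τ] (ν : Measure F)
    (hτ : ∀ l, τ.map (fun y => y l) = ν) {s : (ι → E) → ι} (hs : Measurable s)
    {C : Set (E × F)} (hC : MeasurableSet C) :
    (π.prod τ) {q | (q.1 (s q.1), q.2 (s q.1)) ∈ C} =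
      ∫⁻ u, π {x | (x (s x), u) ∈ C} ∂ν := by
  have hsl : ∀ l, MeasurableSet {x | s x = l} := fun l => hs (measurableSet_singleton l)
  have hD : ∀ l, MeasurableSet {q : (ι → E) × F | s q.1 = l ∧ (q.1 l, q.2) ∈ C} := by
    intro l
    have h1 : Measurable fun q : (ι → E) × F => (q.1 l, q.2) := by fun_prop
    exact (measurable_fst (hsl l)).inter (h1 hC)
  have hE : ∀ l, MeasurableSet
      {q : (ι → E) × (ι → F) | s q.1 = l ∧ (q.1 l, q.2 l) ∈ C} := by
    intro l
    have h1 : Measurable fun q : (ι → E) × (ι → F) => (q.1, q.2 l) := by fun_prop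
    exact h1 (hD l)
  have hsec : ∀ l u, MeasurableSet {x : ι → E | s x = l ∧ (x l, u) ∈ C} := by
    intro l u
    have h1 : Measurable fun x : ι → E => (x, u) := by fun_prop
    exact h1 (hD l)
  -- On each piece the index is fixed, so `τ` enters only through its marginals; dependence among
  -- its coordinates is harmless.
  have hunion : {q : (ι → E) × (ι → F) | (q.1 (s q.1), q.2 (s q.1)) ∈ C} =
      ⋃ l ∈ (Finset.univ : Finset ι), {q | s q.1 = l ∧ (q.1 l, q.2 l) ∈ C} := by
    ext q
    simp
  have hsum : ∀ u, π {x | (x (s x), u) ∈ C} = ∑ l, π {x | s x = l ∧ (x l, u) ∈ C} := by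
    intro u
    have hunion' : {x : ι → E | (x (s x), u) ∈ C} =
        ⋃ l ∈ (Finset.univ : Finset ι), {x | s x = l ∧ (x l, u) ∈ C} := by
      ext x
      simp
    rw [hunion', measure_biUnion_finset (fun l _ l' _ hne => Set.disjoint_left.2
      fun x hx hx' => hne (hx.1.symm.trans hx'.1)) fun l _ => hsec l u]
  rw [hunion, measure_biUnion_finset (fun l _ l' _ hne => Set.disjoint_left.2 fun q hq hq' =>
    hne (hq.1.symm.trans hq'.1)) fun l _ => hE l]
  have hmeas : ∀ l, Measurable fun u => π {x | s x = l ∧ (x l, u) ∈ C} := fun l =>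
    measurable_measure_prodMk_right (hD l)
  rw [lintegral_congr hsum, lintegral_finsetSum _ fun l _ => hmeas l]
  refine Finset.sum_congr rfl fun l _ => ?_
  rw [Measure.prod_apply_symm (hE l), ← hτ l,
    lintegral_map (hmeas l) (measurable_pi_apply l)]
  rfl

/-- Complementary outage probability as an average over the second hop. -/
lemma pi_prod_real_setOf_le_sndr {N m : ℕ} (hm : 1 ≤ m ∧ m ≤ N) {v ρ P₁ σ₀ α β γbar₂ : ℝ}
    (hv : 0 < v) (hρ : 0 ≤ ρ ∧ ρ ≤ 1) (hP₁ : 0 < P₁) (hσ₀ : 0 < σ₀) (hα : 0 < α) (hβ : 0 < β)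
    (hγbar₂ : 0 < γbar₂) (τ : Measure (Fin N → ℝ)) [SFinite τ]
    (hτ : ∀ l, τ.map (fun y => y l) = gammaGammaSNR α β γbar₂) {I κ M γ : ℝ} (hI : 0 ≤ I)
    (hκ : 0 < κ) (hM : 0 ≤ M) (hγ0 : 0 < γ) (hγ : I * γ < 1) :
    ((Measure.pi fun _ : Fin N => outdatedGainLaw v ρ).prod τ).real
      {q | γ ≤ sndr I κ M
        (hopSNR P₁ σ₀ (q.1 (selectedRelay hm fun j => hopSNR P₁ σ₀ (q.1 j).1)).2)
        (q.2 (selectedRelay hm fun j => hopSNR P₁ σ₀ (q.1 j).1))} =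
    m * N.choose m * ∑ n ∈ Finset.range m,
      (m - 1).choose n * ((-1) ^ n / ((N : ℝ) - m + n + 1)) *
        (Real.exp (-(((N : ℝ) - m + n + 1) * κ * (1 + I) * γ /
          ((((N : ℝ) - m + n) * (1 - ρ) + 1) * (1 - I * γ) * (P₁ * v / σ₀ ^ 2)))) *
        ∫ u, Real.exp (-(((M + κ) * ((N : ℝ) - m + n + 1) * (1 + I) * γ /
          ((((N : ℝ) - m + n) * (1 - ρ) + 1) * (1 - I * γ) * (P₁ * v / σ₀ ^ 2))) / u))
          ∂gammaGammaSNR α β γbar₂) := by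
  have hprob := isProbabilityMeasure_gammaGammaSNR hα hβ hγbar₂
  set ν := gammaGammaSNR α β γbar₂ with hν
  have hpos : ∀ᵐ u ∂ν, 0 < u := ae_pos_gammaGammaSNR α β γbar₂
  have h1γ : 0 < 1 - I * γ := sub_pos.2 hγ
  have hmN : (m : ℝ) ≤ N := by exact_mod_cast hm.2
  have hk : ∀ n : ℕ, 0 < (N : ℝ) - m + n + 1 := fun n => by
    have : (0 : ℝ) ≤ n := Nat.cast_nonneg n
    linarith
  have hd : ∀ n : ℕ, 0 < ((N : ℝ) - m + n) * (1 - ρ) + 1 := fun n => by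
    have : (0 : ℝ) ≤ n := Nat.cast_nonneg n
    have := mul_nonneg (show 0 ≤ (N : ℝ) - m + n by linarith) (sub_nonneg.2 hρ.2)
    linarith
  set s : (Fin N → ℂ × ℂ) → Fin N := fun x =>
    selectedRelay hm fun j => hopSNR P₁ σ₀ (x j).1 with hsdef
  have hs : Measurable s := (measurable_selectedRelay hm).comp (measurable_pi_lambda _ fun j =>
    (measurable_hopSNR P₁ σ₀).comp (measurable_fst.comp (measurable_pi_apply j)))
  have hC : MeasurableSet {q : (ℂ × ℂ) × ℝ | γ ≤ sndr I κ M (hopSNR P₁ σ₀ q.1.2) q.2} := by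
    refine measurableSet_le measurable_const ((measurable_sndr I κ M).comp (.prodMk
      ((measurable_hopSNR P₁ σ₀).comp (by fun_prop)) (by fun_prop)))
  have hsel := prod_setOf_selected_mem (Measure.pi fun _ : Fin N => outdatedGainLaw v ρ) τ ν hτ hs
    hC
  have hinner : ∀ᵐ u ∂ν, (Measure.pi fun _ : Fin N => outdatedGainLaw v ρ).real
      {x | γ ≤ sndr I κ M (hopSNR P₁ σ₀ (x (s x)).2) u} = m * N.choose m * ∑ n ∈ Finset.range m,
      (m - 1).choose n * ((-1) ^ n / ((N : ℝ) - m + n + 1)) *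
        (Real.exp (-(((N : ℝ) - m + n + 1) * κ * (1 + I) * γ /
          ((((N : ℝ) - m + n) * (1 - ρ) + 1) * (1 - I * γ) * (P₁ * v / σ₀ ^ 2)))) *
        Real.exp (-(((M + κ) * ((N : ℝ) - m + n + 1) * (1 + I) * γ /
          ((((N : ℝ) - m + n) * (1 - ρ) + 1) * (1 - I * γ) * (P₁ * v / σ₀ ^ 2))) / u))) := by
    filter_upwards [hpos] with u hu
    -- The threshold of `le_sndr_iff`, rescaled from SNR to channel power.
    set t := σ₀ ^ 2 / P₁ * (γ * (1 + I) * (κ + (M + κ) / u) / (1 - I * γ)) with ht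
    have ht0 : 0 ≤ t := by positivity
    have hset : {x : Fin N → ℂ × ℂ | γ ≤ sndr I κ M (hopSNR P₁ σ₀ (x (s x)).2) u} =
        {x | t ≤ ‖(x (s x)).2‖ ^ 2} := by
      ext x
      change γ ≤ sndr I κ M (hopSNR P₁ σ₀ (x (s x)).2) u ↔ t ≤ ‖(x (s x)).2‖ ^ 2
      rw [le_sndr_iff hI hκ hM (hopSNR_nonneg hP₁ _) hu hγ, hopSNR,
        le_div_iff₀ (by positivity), ← div_le_iff₀' hP₁, ht]
      ring_nf
    rw [hset, pi_real_setOf_le_selected hv hρ hP₁ hσ₀ ht0 hm]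
    congr 1
    refine Finset.sum_congr rfl fun n _ => ?_
    congr 1
    rw [← Real.exp_add]
    congr 1
    have := hk n
    have := hd n
    rw [ht]
    field_simp
    ring
  have hint : ∀ a : ℝ, 0 ≤ a → Integrable (fun u => Real.exp (-(a / u))) ν := by
    intro a ha
    refine Integrable.of_bound (Measurable.aestronglyMeasurable (by fun_prop)) 1 ?_
    filter_upwards [hpos] with u hu
    rw [Real.norm_eq_abs, Real.abs_exp, Real.exp_le_one_iff, neg_nonpos]
    positivity
  have hint' := fun n : ℕ => hint ((M + κ) * ((N : ℝ) - m + n + 1) * (1 + I) * γ /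
    ((((N : ℝ) - m + n) * (1 - ρ) + 1) * (1 - I * γ) * (P₁ * v / σ₀ ^ 2))) (by
      have := hk n
      have := hd n
      positivity)
  have hinner' := hinner.mono fun u hu =>
    (ofReal_measureReal (μ := Measure.pi fun _ : Fin N => outdatedGainLaw v ρ)).symm.trans
      (congrArg ENNReal.ofReal hu)
  rw [measureReal_def]
  refine (congrArg ENNReal.toReal (hsel.trans (lintegral_congr_ae hinner'))).trans ?_
  rw [← integral_eq_lintegral_of_nonneg_ae]
  · rw [integral_const_mul, integral_finsetSum]
    · simp_rw [integral_const_mul]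
    · exact fun n _ => ((hint' n).const_mul _).const_mul _
  · filter_upwards [hinner] with u hu
    rw [← hu]
    exact measureReal_nonneg
  · exact Measurable.aestronglyMeasurable (by fun_prop)

end RelayFSO

/-! ### The outage probability. -/

theorem mainTheorem1
    {Ω : Type*} [MeasurableSpace Ω] (P : Measure Ω) [IsProbabilityMeasure P]
    -- number of relays and rank of the selected one
    (N m : ℕ) (hm : 1 ≤ m ∧ m ≤ N)
    -- source power, noise standard deviation, mean power and time correlation of the RF channels
    (P₁ σ₀ v ρ : ℝ) (hP₁ : 0 < P₁) (hσ₀ : 0 < σ₀) (hv : 0 < v) (hρ : 0 ≤ ρ ∧ ρ ≤ 1)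
    -- parameters of the Gamma-Gamma fading of the FSO channels
    (α β γbar₂ : ℝ) (hα : 0 < α) (hβ : 0 < β) (hγbar₂ : 0 < γbar₂)
    -- relay amplifier: model, saturation magnitude, square root of the mean power
    (pa : RelayFSO.Amplifier) (A σ : ℝ) (hA : 0 < A) (hσ : 0 < σ)
    -- IQ imbalance of the destination
    (ζ θ : ℝ) (hω₁ : RelayFSO.omega1 ζ θ ≠ 0)
    -- outdated and current RF gains of the relays, and their FSO SNRs
    (hOld hNew : Fin N → Ω → ℂ) (Y : Fin N → Ω → ℝ)
    (hRFlaw : ∀ l, HasLaw (fun ω => (hOld l ω, hNew l ω)) (RelayFSO.outdatedGainLaw v ρ) P)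
    (hRFindep : iIndepFun (fun l ω => (hOld l ω, hNew l ω)) P)
    (hFSOlaw : ∀ l, HasLaw (Y l) (RelayFSO.gammaGammaSNR α β γbar₂) P)
    (hHops : IndepFun (fun ω l => (hOld l ω, hNew l ω)) (fun ω l => Y l ω) P)
    -- outage threshold
    (γth : ℝ) (hγth : 0 < γth) :
    -- selected relay, its RF gain, and its instantaneous SNRs at the time of transmission
    let sel : Ω → Fin N := fun ω =>
      RelayFSO.selectedRelay hm (fun l => RelayFSO.hopSNR P₁ σ₀ (hOld l ω))
    let h : Ω → ℂ := fun ω => hNew (sel ω) ω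
    let snr₁ : Ω → ℝ := fun ω => RelayFSO.hopSNR P₁ σ₀ (h ω)
    let snr₂ : Ω → ℝ := fun ω => Y (sel ω) ω
    let meanSnr₁ : ℝ := ∫ ω, snr₁ ω ∂P
    let κ : ℝ := RelayFSO.kappa pa A σ (∫ ω, ‖h ω‖ ^ 2 ∂P) P₁ σ₀
    let ILR : ℝ := RelayFSO.imageLeakageRatio ζ θ
    -- average SNR of an RF channel
    let γbar₁ : ℝ := P₁ * v / σ₀ ^ 2
    let Pout : ℝ := P.real {ω | RelayFSO.sndr ILR κ meanSnr₁ (snr₁ ω) (snr₂ ω) < γth}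
    (ILR * γth < 1 →
      (Pout : ℂ) = 1 -
        ((2 ^ (α + β - 2) / (Real.pi * Real.Gamma α * Real.Gamma β) * (m * N.choose m) : ℝ) : ℂ) *
        ∑ n ∈ Finset.range m,
          (((m - 1).choose n * ((-1) ^ n / ((N : ℝ) - m + n + 1)) *
            Real.exp (-(((N : ℝ) - m + n + 1) * κ * (1 + ILR) * γth /
              ((((N : ℝ) - m + n) * (1 - ρ) + 1) * (1 - ILR * γth) * γbar₁))) : ℝ) : ℂ) *
          RelayFSO.meijerG 5 0 (![] : Fin 0 → ℂ)
            ![(α : ℂ) / 2, ((α : ℂ) + 1) / 2, (β : ℂ) / 2, ((β : ℂ) + 1) / 2, 0]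
            (((α * β) ^ 2 * (meanSnr₁ + κ) * ((N : ℝ) - m + n + 1) * (1 + ILR) * γth /
              (16 * (((N : ℝ) - m + n) * (1 - ρ) + 1) * (1 - ILR * γth) * γbar₁ * γbar₂) : ℝ) : ℂ)) ∧
    (1 ≤ ILR * γth → Pout = 1) 
:= by
  intro sel h snr₁ snr₂ meanSnr₁ κ ILR γbar₁ Pout
  -- The mean SNR, κ and ILR enter the argument only as constants with these signs.
  have hM : 0 ≤ meanSnr₁ := integral_nonneg fun ω => RelayFSO.hopSNR_nonneg hP₁ _
  have hκ : 0 < κ := one_pos.trans_le (RelayFSO.one_le_kappa _ _ _ _ _ _)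
  have hI : 0 ≤ ILR := sq_nonneg _
  have hXm : AEMeasurable (fun ω l => (hOld l ω, hNew l ω)) P :=
    aemeasurable_pi_lambda _ fun l => (hRFlaw l).aemeasurable
  have hYm : AEMeasurable (fun ω l => Y l ω) P :=
    aemeasurable_pi_lambda _ fun l => (hFSOlaw l).aemeasurable
  have hX : P.map (fun ω l => (hOld l ω, hNew l ω)) =
      Measure.pi fun _ : Fin N => RelayFSO.outdatedGainLaw v ρ := by
    rw [(iIndepFun_iff_map_fun_eq_pi_map fun l => (hRFlaw l).aemeasurable).1 hRFindep]
    simp_rw [fun l => (hRFlaw l).map_eq]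
  set τ := P.map (fun ω l => Y l ω) with hτdef
  have hτ : ∀ l, τ.map (fun y => y l) = RelayFSO.gammaGammaSNR α β γbar₂ := by
    intro l
    rw [hτdef, AEMeasurable.map_map_of_aemeasurable (measurable_pi_apply l).aemeasurable hYm]
    exact (hFSOlaw l).map_eq
  have hW := (indepFun_iff_map_prod_eq_prod_map_map hXm hYm).1 hHops
  rw [hX, ← hτdef] at hW
  constructor
  · intro hlt
    set D : Set ((Fin N → ℂ × ℂ) × (Fin N → ℝ)) := {q | γth ≤ RelayFSO.sndr ILR κ meanSnr₁
      (RelayFSO.hopSNR P₁ σ₀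
        (q.1 (RelayFSO.selectedRelay hm fun j => RelayFSO.hopSNR P₁ σ₀ (q.1 j).1)).2)
      (q.2 (RelayFSO.selectedRelay hm fun j => RelayFSO.hopSNR P₁ σ₀ (q.1 j).1))} with hD
    have hs : Measurable fun x : Fin N → ℂ × ℂ =>
        RelayFSO.selectedRelay hm fun j => RelayFSO.hopSNR P₁ σ₀ (x j).1 :=
      (RelayFSO.measurable_selectedRelay hm).comp (measurable_pi_lambda _ fun j =>
        (RelayFSO.measurable_hopSNR P₁ σ₀).comp (measurable_fst.comp (measurable_pi_apply j)))
    have hDm : MeasurableSet D := by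
      have h1 : Measurable fun p : (Fin N → ℂ × ℂ) × Fin N => p.1 p.2 :=
        measurable_from_prod_countable_left fun l => measurable_pi_apply l
      have h2 : Measurable fun p : (Fin N → ℝ) × Fin N => p.1 p.2 :=
        measurable_from_prod_countable_left fun l => measurable_pi_apply l
      exact measurableSet_le measurable_const ((RelayFSO.measurable_sndr ILR κ meanSnr₁).comp
        (.prodMk ((RelayFSO.measurable_hopSNR P₁ σ₀).comp (measurable_snd.comp
          (h1.comp (measurable_fst.prodMk (hs.comp measurable_fst)))))
          (h2.comp (measurable_snd.prodMk (hs.comp measurable_fst)))))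
    have hPout : Pout = 1 - ((Measure.pi fun _ : Fin N => RelayFSO.outdatedGainLaw v ρ).prod
        τ).real D := by
      have := Measure.isProbabilityMeasure_map (hXm.prodMk hYm)
      rw [← hW, ← probReal_compl_eq_one_sub hDm, measureReal_def,
        Measure.map_apply_of_aemeasurable (hXm.prodMk hYm) hDm.compl]
      change (P _).toReal = _
      congr 2
      ext ω
      change _ < γth ↔ ¬ γth ≤ _
      exact not_le.symm
    rw [hPout, hD, RelayFSO.pi_prod_real_setOf_le_sndr hm hv hρ hP₁ hσ₀ hα hβ hγbar₂ τ hτ hI hκ hM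
      hγth hlt]
    rw [Complex.ofReal_sub, Complex.ofReal_one, Complex.ofReal_mul, Complex.ofReal_sum,
      Finset.mul_sum, Finset.mul_sum]
    congr 1
    refine Finset.sum_congr rfl fun n _ => ?_
    have hmN : (m : ℝ) ≤ N := by exact_mod_cast hm.2
    have hn : (0 : ℝ) ≤ n := Nat.cast_nonneg n
    have hk : 0 < (N : ℝ) - m + n + 1 := by linarith
    have hd : 0 < ((N : ℝ) - m + n) * (1 - ρ) + 1 := by
      have := mul_nonneg (show 0 ≤ (N : ℝ) - m + n by linarith) (sub_nonneg.2 hρ.2)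
      linarith
    have h1 : 0 < 1 - ILR * γth := sub_pos.2 hlt
    have hγ₁ : 0 < γbar₁ := by positivity
    -- Regroups the argument as (αβ)²a/(16 γbar₂), with a the coefficient of 1/u in the exponent.
    have hz : (α * β) ^ 2 * (meanSnr₁ + κ) * ((N : ℝ) - m + n + 1) * (1 + ILR) * γth /
        (16 * (((N : ℝ) - m + n) * (1 - ρ) + 1) * (1 - ILR * γth) * γbar₁ * γbar₂) =
        (α * β) ^ 2 * ((meanSnr₁ + κ) * ((N : ℝ) - m + n + 1) * (1 + ILR) * γth /
          ((((N : ℝ) - m + n) * (1 - ρ) + 1) * (1 - ILR * γth) * γbar₁)) / (16 * γbar₂) := by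
      field_simp
    rw [hz, show P₁ * v / σ₀ ^ 2 = γbar₁ from rfl, ← mul_assoc (_ * _) (Real.exp _),
      Complex.ofReal_mul (_ * _) (integral _ _),
      RelayFSO.integral_exp_neg_div_eq_meijerG hα hβ hγbar₂ (by positivity)]
    simp only [Complex.ofReal_mul]
    ring
  · intro hge
    -- Positivity is needed for all relays at once, because the selected index is random.
    have hpos : ∀ᵐ ω ∂P, ∀ l, 0 < Y l ω := by
      rw [ae_all_iff]
      intro l
      refine ae_of_ae_map (hFSOlaw l).aemeasurable ?_
      rw [(hFSOlaw l).map_eq]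
      exact RelayFSO.ae_pos_gammaGammaSNR α β γbar₂
    have hae : ∀ᵐ ω ∂P, RelayFSO.sndr ILR κ meanSnr₁ (snr₁ ω) (snr₂ ω) < γth := by
      filter_upwards [hpos] with ω hω
      exact RelayFSO.sndr_lt hI hκ hM (RelayFSO.hopSNR_nonneg hP₁ _) (hω _) hγth hge
    change P.real _ = 1
    rw [measureReal_def, measure_congr (Filter.eventuallyEq_univ.2 hae), measure_univ,
      ENNReal.toReal_one]
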